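/- **Conventions.** Let $(V,g)$ be a finite-dimensional real vector space with a non-degenerate symmetric bilinear form of signature $(p,q)$ ($p$ negative and $q$ positive directions), and let $R(x,y)\in\operatorname{End}(V)$ be the curvature operators of an algebraic curvature tensor on $V$, so $R(x,y,z,w)=g(R(x,y)z,w)$. A $k$-plane is *spacelike* (resp. *timelike*) if $g$ is positive (resp. negative) definite on it; an orthonormal basis of it satisfies $g(e_i,e_j)=\delta_{ij}$ (resp. $-\delta_{ij}$). For an oriented spacelike $2$-plane $\pi$ with oriented orthonormal basis $\{e_1,e_2\}$ put $\mathcal R(\pi):=R(e_1,e_2)$; for a spacelike or timelike $k$-plane $\pi$ with orthonormal basis $\{e_1,\dots,e_k\}$ put $\Theta(\pi):=\sum_{i,j=1}^k R(e_i,e_j)R(e_i,e_j)$. Both are independent of the basis chosen. The space $(V,g,R)$ - has *spacelike rank $r$* if $\operatorname{rank}\mathcal R(\pi)=r$ for every oriented spacelike $2$-plane $\pi$; - is *spacelike Jordan Ivanov–Petrova* if the Jordan normal form (conjugacy class) of $\mathcal R(\pi)$ is the same for all oriented spacelike $2$-planes $\pi$; - is *$k$-spacelike* (resp. *$k$-timelike*)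 *Jordan Stanilov* if the Jordan normal form of $\Theta(\pi)$ is the same for all spacelike (resp. timelike) $k$-planes $\pi$. A smooth pseudo-Riemannian manifold $(M,g)$, with Riemann curvature $R$ of its Levi-Civita connection, is spacelike Jordan Ivanov–Petrova, resp. $k$-spacelike or $k$-timelike Jordan Stanilov, if $(T_PM,g_P,R_P)$ is so for every $P\in M$; the Jordan normal form may depend on $P$. **Theorem 1.4.** Let $(M,g)$ be a connected spacelike Jordan Ivanov–Petrova pseudo-Riemannian manifold of signature $(p,q)$, where either $(p,q)=(0,4)$ or $q\ge5$. Assume that $\mathcal R(\pi)$ is not nilpotent for at least one oriented spacelike $2$-plane $\pi$ tangent to $M$, and that $(T_PM,g_P,R_P)$ has spacelike rank $2$ for every $P\in M$. Then 1. $(M,g)$ is $k$-spacelike Jordan Stanilov for every $k$ with $2\le k\le q$; 2. $(M,g)$ is $k$-timelike Jordan Stanilov for every $k$ with $2\le k\le p$. -/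

import Mathlib

set_option maxSynthPendingDepth 3

open scoped Manifold ContDiff

noncomputable section

namespace StanilovIP

/-! ### Algebra: a vector space with an inner product `g` and a curvature operator `R(x, y)` -/

section Algebra

variable {V : Type*} [AddCommGroup V] [Module ℝ V]

/-- The symmetric bilinear form `g` is non-degenerate of signature `(p, q)`:
`p` is the number of negative directions and `q` is the number of positive directions. -/
def HasSignature (g : LinearMap.BilinForm ℝ V) (p q : ℕ) : Prop :=
  g.Nondegenerate ∧ sigNeg g.toQuadraticMap = p ∧
    sigPos g.toQuadraticMap = q

/-- The causal type of a definite plane. -/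
inductive Causal
  | spacelike
  | timelike

/-- The sign `+1` of spacelike unit vectors and the sign `-1` of timelike unit vectors. -/
def Causal.sign : Causal → ℝ
  | .spacelike => 1
  | .timelike => -1

/-- The (unoriented) Grassmannian `Gr_{k,±}(V, g)` of spacelike, resp. timelike, `k`-planes. -/
def Gr (g : LinearMap.BilinForm ℝ V) (ε : Causal) (k : ℕ) : Set (Submodule ℝ V) :=
  {π | FiniteDimensional ℝ π ∧ Module.finrank ℝ π = k ∧
    ∀ x ∈ π, x ≠ 0 → 0 < ε.sign * g x x}

/-- `e` is an orthonormal basis of the plane `π` of causal type `ε`, i.e. `g (e i) (e j) = ± δ_{ij}`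
and the `e i` span `π` (their linear independence is automatic). Since `e` is an ordered basis, it
also determines an orientation of `π`, and every orientation of `π` is obtained in this way. -/
def IsOrthonormalBasisOf (g : LinearMap.BilinForm ℝ V) (ε : Causal) {k : ℕ} (e : Fin k → V)
    (π : Submodule ℝ V) : Prop :=
  (∀ i j, g (e i) (e j) = if i = j then ε.sign else 0) ∧ Submodule.span ℝ (Set.range e) = π

/-- The skew-symmetric curvature operator `R(π) = R(e₁, e₂)` of the oriented `2`-plane with oriented
orthonormal basis `e`. -/
def skewCurvature (R : V → V → Module.End ℝ V) (e : Fin 2 → V) : Module.End ℝ V :=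
  R (e 0) (e 1)

/-- The higher order curvature operator `Θ(π) = ∑_{i,j} R(e_i, e_j) R(e_i, e_j)` of the `k`-plane
with orthonormal basis `e`. -/
def higherCurvature (R : V → V → Module.End ℝ V) {k : ℕ} (e : Fin k → V) : Module.End ℝ V :=
  ∑ i, ∑ j, R (e i) (e j) * R (e i) (e j)

/-- Constant rank `r`: `Rank R(π) = r` for every oriented `2`-plane `π` of causal type `ε`. -/
def HasConstantRank (g : LinearMap.BilinForm ℝ V) (R : V → V → Module.End ℝ V) (ε : Causal)
    (r : ℕ) : Prop :=
  ∀ π ∈ Gr g ε 2, ∀ e : Fin 2 → V, IsOrthonormalBasisOf g ε e π →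
    Module.finrank ℝ (LinearMap.range (skewCurvature R e)) = r

/-- Jordan Ivanov-Petrova: the Jordan normal form (i.e. the conjugacy class) of `R(π)` is
constant on the Grassmannian of oriented `2`-planes of causal type `ε`. -/
def IsJordanIvanovPetrova (g : LinearMap.BilinForm ℝ V) (R : V → V → Module.End ℝ V)
    (ε : Causal) : Prop :=
  ∀ π ∈ Gr g ε 2, ∀ σ ∈ Gr g ε 2, ∀ e f : Fin 2 → V,
    IsOrthonormalBasisOf g ε e π → IsOrthonormalBasisOf g ε f σ →
      IsConj (skewCurvature R e) (skewCurvature R f)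

/-- `k`-Jordan Stanilov: the Jordan normal form (i.e. the conjugacy class) of `Θ(π)` is
constant on the Grassmannian of `k`-planes of causal type `ε`. -/
def IsJordanStanilov (g : LinearMap.BilinForm ℝ V) (R : V → V → Module.End ℝ V) (ε : Causal)
    (k : ℕ) : Prop :=
  ∀ π ∈ Gr g ε k, ∀ σ ∈ Gr g ε k, ∀ e f : Fin k → V,
    IsOrthonormalBasisOf g ε e π → IsOrthonormalBasisOf g ε f σ →
      IsConj (higherCurvature R e) (higherCurvature R f)

end Algebra

/-! ### Local differential geometry: a metric `G` on an open subset of `E` -/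

section Local

variable {E : Type*} [NormedAddCommGroup E] [NormedSpace ℝ E]

/-- The Christoffel symbols of the first kind, as the trilinear form
`(u, v, w) ↦ ½ (∂_u G(v, w) + ∂_v G(u, w) - ∂_w G(u, v))`. -/
def christoffelFirst (G : E → E →L[ℝ] E →L[ℝ] ℝ) (y : E) : E →L[ℝ] E →L[ℝ] E →L[ℝ] ℝ :=
  (1 / 2 : ℝ) • (fderiv ℝ G y + (fderiv ℝ G y).flip -
    (ContinuousLinearMap.flipₗᵢ ℝ E E ℝ).toContinuousLinearEquiv.toContinuousLinearMap.comp
      (fderiv ℝ G y).flip)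

lemma christoffelFirst_apply (G : E → E →L[ℝ] E →L[ℝ] ℝ) (y u v w : E) :
    christoffelFirst G y u v w =
      1 / 2 * (fderiv ℝ G y u v w + fderiv ℝ G y v u w - fderiv ℝ G y w u v) := by
  simp [christoffelFirst]

/-- The Christoffel symbols of the second kind, as a bilinear map: `Γ(u, v)` is the vector `∇_u v`
for constant vector fields `u`, `v`, i.e. `G(Γ(u, v), w)` is the Christoffel symbol of the first
kind. (`ContinuousLinearMap.inverse` is the inverse of `G y : E → E*`, which is invertible wherever
`G y` is non-degenerate and `E` is finite dimensional.) -/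
def christoffel (G : E → E →L[ℝ] E →L[ℝ] ℝ) (y : E) : E →L[ℝ] E →L[ℝ] E :=
  ContinuousLinearMap.compL ℝ E (E →L[ℝ] ℝ) E (G y).inverse ∘L christoffelFirst G y

lemma christoffel_apply (G : E → E →L[ℝ] E →L[ℝ] ℝ) (y u v : E) :
    christoffel G y u v = (G y).inverse (christoffelFirst G y u v) := rfl

/-- The Riemann curvature operator of the Levi-Civita connection of `G`,
`R(u, v) = (∂_u Γ)(v, ·) - (∂_v Γ)(u, ·) + Γ(u, Γ(v, ·)) - Γ(v, Γ(u, ·))`,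
that is `R(u, v) = ∇_u ∇_v - ∇_v ∇_u` for constant vector fields `u`, `v`. -/
def localCurvature (G : E → E →L[ℝ] E →L[ℝ] ℝ) (y u v : E) : E →L[ℝ] E :=
  fderiv ℝ (christoffel G) y u v - fderiv ℝ (christoffel G) y v u
    + christoffel G y u ∘L christoffel G y v - christoffel G y v ∘L christoffel G y u

end Local

/-! ### Pseudo-Riemannian manifolds -/

section Manifold

variable (E : Type*) [NormedAddCommGroup E] [NormedSpace ℝ E]
  (M : Type*) [TopologicalSpace M] [ChartedSpace E M] [IsManifold 𝓘(ℝ, E) ∞ M]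

/-- A bounded bilinear form on a tangent space as an algebraic bilinear form. -/
def toBilin {E M} [NormedAddCommGroup E] [NormedSpace ℝ E] [TopologicalSpace M] [ChartedSpace E M]
    {P : M} (b : TangentSpace 𝓘(ℝ, E) P →L[ℝ] TangentSpace 𝓘(ℝ, E) P →L[ℝ] ℝ) :
    LinearMap.BilinForm ℝ (TangentSpace 𝓘(ℝ, E) P) :=
  LinearMap.mk₂ ℝ (fun x y => b x y) (by simp) (by simp) (by simp) (by simp)

/-- A smooth pseudo-Riemannian metric of signature `(p, q)` on `M`. -/
structure PseudoRiemannianMetric (p q : ℕ) where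
  /-- the inner product on each tangent space -/
  val (P : M) : TangentSpace 𝓘(ℝ, E) P →L[ℝ] TangentSpace 𝓘(ℝ, E) P →L[ℝ] ℝ
  symm (P : M) (x y : TangentSpace 𝓘(ℝ, E) P) : val P x y = val P y x
  signature (P : M) : HasSignature (toBilin (val P)) p q
  contMDiff : ContMDiff 𝓘(ℝ, E) (𝓘(ℝ, E).prod 𝓘(ℝ, E →L[ℝ] E →L[ℝ] ℝ)) ∞
    (fun P ↦ Bundle.TotalSpace.mk' (E →L[ℝ] E →L[ℝ] ℝ)
      (E := fun P : M ↦ (TangentSpace 𝓘(ℝ, E) P →L[ℝ] TangentSpace 𝓘(ℝ, E) P →L[ℝ] ℝ)) P (val P))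

namespace PseudoRiemannianMetric

variable {E M} {p q : ℕ} (g : PseudoRiemannianMetric E M p q)

/-- The inner product `g_P` on the tangent space `T_P M`. -/
def form (P : M) : LinearMap.BilinForm ℝ (TangentSpace 𝓘(ℝ, E) P) := toBilin (g.val P)

/-- The differential at `y` of the inverse of the preferred chart at `P`. -/
def chartInvDeriv (P : M) (y : E) :
    E →L[ℝ] TangentSpace 𝓘(ℝ, E) ((chartAt E P).symm y) :=
  mfderiv 𝓘(ℝ, E) 𝓘(ℝ, E) (chartAt E P).symm y

/-- The differential at `P` of the preferred chart at `P`. -/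
def chartDeriv (P : M) : TangentSpace 𝓘(ℝ, E) P →L[ℝ] E :=
  mfderiv 𝓘(ℝ, E) 𝓘(ℝ, E) (chartAt E P) P

/-- The metric in the preferred chart at `P`, i.e. its pull-back under the inverse of the chart. -/
def inChart (P : M) (y : E) : E →L[ℝ] E →L[ℝ] ℝ :=
  ContinuousLinearMap.bilinearComp (E := E) (F := E)
    (g.val ((chartAt E P).symm y)) (chartInvDeriv P y) (chartInvDeriv P y)

/-- The curvature operator `R_P(x, y)` on `T_P M` of the Levi-Civita connection of `g`, computed in
the preferred chart at `P` and transported to `T_P M` by the differential of the chart. -/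
def curvature (P : M) (x y : TangentSpace 𝓘(ℝ, E) P) :
    Module.End ℝ (TangentSpace 𝓘(ℝ, E) P) :=
  (chartDeriv P).inverse.toLinearMap ∘ₗ
    (localCurvature (g.inChart P) (chartAt E P P) (chartDeriv P x) (chartDeriv P y)).toLinearMap ∘ₗ
      (chartDeriv P).toLinearMap

/-- `(M, g)` has constant spacelike or timelike rank `r` at every point. -/
def HasConstantRank (ε : Causal) (r : ℕ) : Prop :=
  ∀ P : M, StanilovIP.HasConstantRank (g.form P) (g.curvature P) ε r

/-- `(M, g)` is spacelike or timelike Jordan Ivanov-Petrova. The Jordan normal form may depend on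
the point. -/
def IsJordanIvanovPetrova (ε : Causal) : Prop :=
  ∀ P : M, StanilovIP.IsJordanIvanovPetrova (g.form P) (g.curvature P) ε

/-- `(M, g)` is `k`-spacelike or `k`-timelike Jordan Stanilov. The Jordan normal form may depend on
the point. -/
def IsJordanStanilov (ε : Causal) (k : ℕ) : Prop :=
  ∀ P : M, StanilovIP.IsJordanStanilov (g.form P) (g.curvature P) ε k

/-- Some skew-symmetric curvature operator `R(π)`, for an oriented `2`-plane `π` of causal type `ε`
tangent to `M`, is not nilpotent. -/
def HasNonNilpotentCurvature (ε : Causal) : Prop :=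
  ∃ P : M, ∃ π ∈ Gr (g.form P) ε 2, ∃ e : Fin 2 → TangentSpace 𝓘(ℝ, E) P,
    IsOrthonormalBasisOf (g.form P) ε e π ∧ ¬ IsNilpotent (skewCurvature (g.curvature P) e)

end PseudoRiemannianMetric

end Manifold

end StanilovIP

end

/-!
The assertion concerns one tangent space at a time, and there it is a statement of linear algebra
about an algebraic curvature tensor `F(x, y, z, w) = g(R(x, y) z, w)`. The idea is to show that such
a tensor of spacelike rank two has the form `C (φ(x, w) φ(y, z) - φ(x, z) φ(y, w))` for a symmetric
bilinear form `φ` (`IsSpacelikeRankTwo.exists_form`), and that the operator `Φ` representing `φ` has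
a scalar square `Φ² = r` when the Jordan normal form of the `R(π)` does not depend on the spacelike
plane `π` (`exists_sq_eq_mul`). For an orthonormal basis `e₁, …, e_k` of a plane of either causal
type, `Θ(π)` is then a multiple, depending only on `k` and the causal type, of
`∑ φ(eᵢ, ·) Φ eᵢ` (`higherCurvature_eq`). If `r = 0` it vanishes; otherwise it is a multiple of the
orthogonal projection to the `k`-plane `Φ π`, and projections of the same rank are conjugate.

The form `φ` is found as follows. By density, the rank two condition on spacelike planes makes all
the two-forms `F(x, y)` decomposable, and so the two-forms `F(x, ·)`, for a fixed spacelike `x`, have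
pairwise vanishing wedge products. A linear space of such forms has a common factor `u`, or else it
has dimension at most three and a common kernel vector (`IsSpacelikeRankTwo.factor_or_kernel`). The
second alternative contradicts `q ≥ 5`, and in the Euclidean case of dimension four the Bianchi
identity shows that it forces the Jacobi operator of `x` to vanish. The Bianchi identity also yields
some spacelike `x` whose factor satisfies `u x ≠ 0`
(`IsSpacelikeRankTwo.exists_factor_apply_ne_zero`). Such an `x` splits off from the hyperplane
`ker u`, on which `B(y, z) = F(x, y, z, x)` has rank at least three and divides `F`; hence the
restriction of `F` to `ker u` is a multiple of the curvature tensor of `B`, and `φ` is a combination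
of `u ⊗ u` and `B`.

As for `Φ²`: the trace of `R(π)²` is, up to a constant, the Gram determinant of the form
`h(x, y) = g(Φ x, Φ y)` on `π`. So `Λ²h = d Λ²g`, first on spacelike planes and then by density
everywhere, which makes `h` a multiple of `g` if `d ≠ 0`. If `d = 0`, then `h` has rank at most one,
so that `R(π)² = 0` for one and hence for all spacelike planes `π`, and `h = 0`.

That the curvature of the Levi-Civita connection has the symmetries of an algebraic curvature tensor
is verified in the preferred chart (`IsMetricNear.localCurvature_bianchi`,
`IsMetricNear.localCurvature_skew`); at the base point of this chart its differential is the identity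
of the model space.
-/

namespace StanilovIP

/-! ### Density along lines -/

section Density

open Filter Topology

/-- A quartic polynomial vanishing near `0` has vanishing leading coefficient. -/
lemma quartic_coeff_eq_zero {c₀ c₁ c₂ c₃ c₄ : ℝ}
    (h : ∀ᶠ t in 𝓝 (0 : ℝ), c₀ + c₁ * t + c₂ * t ^ 2 + c₃ * t ^ 3 + c₄ * t ^ 4 = 0) : c₄ = 0 := by
  open Polynomial in
  set P : ℝ[X] := C c₀ + C c₁ * X + C c₂ * X ^ 2 + C c₃ * X ^ 3 + C c₄ * X ^ 4 with hP
  have hinf : Set.Infinite {t | P.IsRoot t} := by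
    refine Set.Infinite.mono (s := {t : ℝ |
      c₀ + c₁ * t + c₂ * t ^ 2 + c₃ * t ^ 3 + c₄ * t ^ 4 = 0}) ?_ (infinite_of_mem_nhds 0 h)
    intro t ht
    simpa [hP, IsRoot] using ht
  have h0 := congrArg (fun p => coeff p 4) (Polynomial.eq_zero_of_infinite_isRoot P hinf)
  simpa [hP, coeff_X, coeff_C, coeff_X_pow] using h0

variable {V X : Type*} [AddCommGroup V] [Module ℝ V] [AddCommGroup X] [Module ℝ X]

lemma eventually_pos_of_line {f : ℝ → ℝ} (hf : Continuous f) (h : 0 < f 0) :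
    ∀ᶠ t in 𝓝 (0 : ℝ), 0 < f t :=
  hf.continuousAt.eventually (lt_mem_nhds h)

/-- The nonzero values of `t` near `0` leave room for an eventual property. -/
lemma exists_ne_zero_of_eventually {p : ℝ → Prop} (h : ∀ᶠ t in 𝓝 (0 : ℝ), p t) :
    ∃ t ≠ 0, p t := by
  have : ∀ᶠ t in 𝓝[≠] (0 : ℝ), p t := h.filter_mono nhdsWithin_le_nhds
  obtain ⟨t, ht, h0⟩ := (this.and self_mem_nhdsWithin).exists
  exact ⟨t, h0, ht⟩

/-- A linear map vanishes at `v` if it vanishes near `y` on the line through `y` with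
direction `v`. -/
lemma linearMap_eq_zero_of_eventually (L : V →ₗ[ℝ] X) {y v : V}
    (h : ∀ᶠ t in 𝓝 (0 : ℝ), L (y + t • v) = 0) : L v = 0 := by
  obtain ⟨t, ht, h1⟩ := exists_ne_zero_of_eventually h
  have h0 : L y = 0 := by simpa using h.self_of_nhds
  simpa [h0, ht] using h1

variable {g : LinearMap.BilinForm ℝ V}

lemma eventually_pos (x v : V) (hx : 0 < g x x) :
    ∀ᶠ t in 𝓝 (0 : ℝ), 0 < g (x + t • v) (x + t • v) := by
  refine eventually_pos_of_line (f := fun t => g (x + t • v) (x + t • v)) ?_ (by simpa)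
  simp only [map_add, map_smul, LinearMap.add_apply, LinearMap.smul_apply, smul_eq_mul]
  fun_prop

/-- The Gram determinant of `x` and `y`. -/
def gramDet (g : LinearMap.BilinForm ℝ V) (x y : V) : ℝ := g x x * g y y - g x y * g y x

lemma eventually_gramDet_pos (x y v w : V) (h : 0 < gramDet g x y) :
    ∀ᶠ t in 𝓝 (0 : ℝ), 0 < gramDet g (x + t • v) (y + t • w) := by
  refine eventually_pos_of_line (f := fun t => gramDet g (x + t • v) (y + t • w)) ?_ (by simpa)
  simp only [gramDet, map_add, map_smul, LinearMap.add_apply, LinearMap.smul_apply, smul_eq_mul]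
  fun_prop

/-- A quadratic form vanishing on spacelike vectors vanishes. -/
lemma apply_self_eq_zero_of_spacelike (b : LinearMap.BilinForm ℝ V) {x₀ : V} (hx₀ : 0 < g x₀ x₀)
    (h : ∀ x, 0 < g x x → b x x = 0) (x : V) : b x x = 0 := by
  apply quartic_coeff_eq_zero (c₀ := 0) (c₁ := 0) (c₂ := b x₀ x₀) (c₃ := b x₀ x + b x x₀)
  filter_upwards [eventually_pos x₀ x hx₀] with t ht
  have := h _ ht
  simp only [map_add, map_smul, LinearMap.add_apply, LinearMap.smul_apply, smul_eq_mul] at this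
  linear_combination t ^ 2 * this

end Density

/-! ### Spacelike vectors subject to linear conditions -/

section PositiveIndex

variable {V : Type*} [AddCommGroup V] [Module ℝ V] {g : LinearMap.BilinForm ℝ V} {n : ℕ}

/-- There is an `n`-dimensional subspace on which `g` is positive definite. -/
def HasPositiveIndex (g : LinearMap.BilinForm ℝ V) (n : ℕ) : Prop :=
  ∃ S : Submodule ℝ V, FiniteDimensional ℝ S ∧ Module.finrank ℝ S = n ∧
    ∀ x ∈ S, x ≠ 0 → 0 < g x x

/-- Fewer than `n` linear conditions leave room for a spacelike vector. -/
lemma HasPositiveIndex.exists_pos (h : HasPositiveIndex g n) {m : ℕ} (hm : m < n)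
    (f : Fin m → V →ₗ[ℝ] ℝ) : ∃ v, 0 < g v v ∧ ∀ i, f i v = 0 := by
  obtain ⟨S, _, hS, hpos⟩ := h
  have hker : LinearMap.ker (LinearMap.pi fun i => (f i).comp S.subtype) ≠ ⊥ := by
    apply LinearMap.ker_ne_bot_of_finrank_lt
    simpa [hS] using hm
  obtain ⟨v, hv, hv0⟩ := Submodule.exists_mem_ne_zero_of_ne_bot hker
  refine ⟨v, hpos v v.2 (by simpa using hv0), fun i => ?_⟩
  have := congrFun (LinearMap.mem_ker.1 hv) i
  simpa using this

lemma HasPositiveIndex.exists_pos₀ (h : HasPositiveIndex g n) (hn : 0 < n) : ∃ v, 0 < g v v := by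
  obtain ⟨v, hv, -⟩ := h.exists_pos hn ![]
  exact ⟨v, hv⟩

lemma HasPositiveIndex.exists_pos₁ (h : HasPositiveIndex g n) (hn : 1 < n) (f : V →ₗ[ℝ] ℝ) :
    ∃ v, 0 < g v v ∧ f v = 0 := by
  obtain ⟨v, hv, h⟩ := h.exists_pos hn ![f]
  exact ⟨v, hv, h 0⟩

lemma HasPositiveIndex.exists_pos₂ (h : HasPositiveIndex g n) (hn : 2 < n)
    (f₁ f₂ : V →ₗ[ℝ] ℝ) : ∃ v, 0 < g v v ∧ f₁ v = 0 ∧ f₂ v = 0 := by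
  obtain ⟨v, hv, h⟩ := h.exists_pos hn ![f₁, f₂]
  exact ⟨v, hv, h 0, h 1⟩

lemma HasPositiveIndex.exists_pos₃ (h : HasPositiveIndex g n) (hn : 3 < n)
    (f₁ f₂ f₃ : V →ₗ[ℝ] ℝ) : ∃ v, 0 < g v v ∧ f₁ v = 0 ∧ f₂ v = 0 ∧ f₃ v = 0 := by
  obtain ⟨v, hv, h⟩ := h.exists_pos hn ![f₁, f₂, f₃]
  exact ⟨v, hv, h 0, h 1, h 2⟩

lemma HasPositiveIndex.exists_pos₄ (h : HasPositiveIndex g n) (hn : 4 < n)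
    (f₁ f₂ f₃ f₄ : V →ₗ[ℝ] ℝ) :
    ∃ v, 0 < g v v ∧ f₁ v = 0 ∧ f₂ v = 0 ∧ f₃ v = 0 ∧ f₄ v = 0 := by
  obtain ⟨v, hv, h⟩ := h.exists_pos hn ![f₁, f₂, f₃, f₄]
  exact ⟨v, hv, h 0, h 1, h 2, h 3⟩

end PositiveIndex

/-! ### Algebraic curvature tensors -/

section Tensor

variable {V : Type*} [AddCommGroup V] [Module ℝ V]

/-- The symmetries of a Riemann curvature tensor `F(x, y, z, w) = g(R(x, y) z, w)`. -/
structure IsCurvatureTensor (F : V →ₗ[ℝ] V →ₗ[ℝ] V →ₗ[ℝ] V →ₗ[ℝ] ℝ) : Prop where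
  skew (x y z w : V) : F x y z w = -F y x z w
  skew' (x y z w : V) : F x y z w = -F x y w z
  bianchi (x y z w : V) : F x y z w + F y z x w + F z x y w = 0

namespace IsCurvatureTensor

variable {F : V →ₗ[ℝ] V →ₗ[ℝ] V →ₗ[ℝ] V →ₗ[ℝ] ℝ}

lemma pair (hF : IsCurvatureTensor F) (x y z w : V) : F x y z w = F z w x y := by
  linarith [hF.bianchi x y z w, hF.bianchi y z w x, hF.bianchi z w x y, hF.bianchi w x y z,
    hF.skew x y z w, hF.skew x y w z, hF.skew y z x w, hF.skew y z w x, hF.skew z x y w,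
    hF.skew z w x y, hF.skew z w y x, hF.skew w x y z, hF.skew w x z y, hF.skew w y z x,
    hF.skew y w z x, hF.skew y w x z, hF.skew x z w y, hF.skew x z y w,
    hF.skew' x y z w, hF.skew' y z x w, hF.skew' z x y w, hF.skew' y z w x, hF.skew' z w y x,
    hF.skew' w y z x, hF.skew' z w x y, hF.skew' w x z y, hF.skew' x z w y, hF.skew' w x y z,
    hF.skew' x y w z, hF.skew' y w x z]

lemma self_left (hF : IsCurvatureTensor F) (x z w : V) : F x x z w = 0 := by
  linarith [hF.skew x x z w]

lemma self_right (hF : IsCurvatureTensor F) (x y z : V) : F x y z z = 0 := by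
  linarith [hF.skew' x y z z]

end IsCurvatureTensor

/-- The polarized Plücker relations of two skew-symmetric forms, i.e. the vanishing of their wedge
product. A nonzero form `α` satisfying `PluckerRel α α` has rank `2`. -/
def PluckerRel (α β : V →ₗ[ℝ] V →ₗ[ℝ] ℝ) : Prop :=
  ∀ a b c d, α a b * β c d + β a b * α c d - α a c * β b d - β a c * α b d +
    α a d * β b c + β a d * α b c = 0

/-- Spacelike rank two, as a condition on a curvature tensor `F` and a symmetric form `g`: every
`F(x, y)` is decomposable, and it does not vanish for orthogonal spacelike `x` and `y`. -/
structure IsSpacelikeRankTwo (g : LinearMap.BilinForm ℝ V)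
    (F : V →ₗ[ℝ] V →ₗ[ℝ] V →ₗ[ℝ] V →ₗ[ℝ] ℝ) : Prop extends IsCurvatureTensor F where
  symm (x y : V) : g x y = g y x
  plucker (x y : V) : PluckerRel (F x y) (F x y)
  ne_zero (x y : V) : 0 < g x x → 0 < g y y → g x y = 0 → F x y ≠ 0

end Tensor

/-! ### Common factors of the forms `F(x, ·)` -/

section CommonFactor

variable {V : Type*} [AddCommGroup V] [Module ℝ V] {g : LinearMap.BilinForm ℝ V}
  {F : V →ₗ[ℝ] V →ₗ[ℝ] V →ₗ[ℝ] V →ₗ[ℝ] ℝ} {n : ℕ}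

/-- The linear form `u` divides all the two-forms `F(x, y)`, for fixed `x`: they vanish on the
hyperplane `ker u`. -/
def IsFactor (F : V →ₗ[ℝ] V →ₗ[ℝ] V →ₗ[ℝ] V →ₗ[ℝ] ℝ) (x : V) (u : V →ₗ[ℝ] ℝ) : Prop :=
  u ≠ 0 ∧ ∀ y z w, u z = 0 → u w = 0 → F x y z w = 0

lemma exists_apply_eq_one {α : V →ₗ[ℝ] ℝ} (h : α ≠ 0) : ∃ v, α v = 1 := by
  obtain ⟨v, hv⟩ := DFunLike.ne_iff.1 h
  exact ⟨(α v)⁻¹ • v, by simpa using inv_mul_cancel₀ hv⟩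

lemma exists_apply₂_eq_one {α : V →ₗ[ℝ] V →ₗ[ℝ] ℝ} (h : α ≠ 0) : ∃ v w, α v w = 1 := by
  obtain ⟨v, hv⟩ := DFunLike.ne_iff.1 h
  exact ⟨v, exists_apply_eq_one hv⟩

namespace IsSpacelikeRankTwo

lemma plucker_right (h : IsSpacelikeRankTwo g F) (x y y' : V) :
    PluckerRel (F x y) (F x y') := by
  intro a b c d
  have h1 := h.plucker x (y + y') a b c d
  have h2 := h.plucker x y a b c d
  have h3 := h.plucker x y' a b c d
  simp only [map_add, LinearMap.add_apply] at h1
  linear_combination (h1 - h2 - h3) / 2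

lemma plucker_left (h : IsSpacelikeRankTwo g F) (x x' y : V) :
    PluckerRel (F x y) (F x' y) := by
  intro a b c d
  have h1 := h.plucker_right y x x' a b c d
  simp only [h.skew y] at h1
  linear_combination h1

/-- Two of the forms `F(x, ·)` are `u ∧ α` and `u ∧ β` with independent `u`, `α`, `β`; the vectors
`a`, `b`, `c` are dual to `u`, `α`, `β`. -/
lemma exists_dual_triple (h : IsSpacelikeRankTwo g F) (hn : HasPositiveIndex g n) (hn3 : 3 ≤ n)
    {x : V} (hx : 0 < g x x) :
    ∃ y₁ y₂ a b c, F x y₁ a b = 1 ∧ F x y₂ a b = 0 ∧ F x y₁ a c = 0 ∧ F x y₂ a c = 1 ∧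
      F x y₁ b c = 0 ∧ F x y₂ b c = 0 := by
  obtain ⟨y₁, hy₁, hxy₁⟩ := hn.exists_pos₁ (by omega) (g x)
  obtain ⟨a, b, hab⟩ := exists_apply₂_eq_one (h.ne_zero x y₁ hx hy₁ hxy₁)
  obtain ⟨y₂, hy₂, hxy₂, hab₂⟩ := hn.exists_pos₂ (by omega) (g x) (((F x).flip a).flip b)
  simp only [LinearMap.flip_apply] at hab₂
  have hne := h.ne_zero x y₂ hx hy₂ hxy₂
  have key : ∃ a b c, F x y₁ a b = 1 ∧ F x y₂ a b = 0 ∧ F x y₂ a c = 1 := by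
    by_cases ha : F x y₂ a = 0
    · by_cases hb : F x y₂ b = 0
      · exfalso
        apply hne
        ext z w
        have := h.plucker_right x y₁ y₂ a b z w
        simpa [hab, ha, hb] using this
      · obtain ⟨c, hc⟩ := exists_apply_eq_one hb
        refine ⟨b, -a, c, ?_, ?_, hc⟩
        · rw [map_neg, ← h.skew', hab]
        · rw [map_neg, ← h.skew', hab₂]
    · obtain ⟨c, hc⟩ := exists_apply_eq_one ha
      exact ⟨a, b, c, hab, hab₂, hc⟩
  obtain ⟨a, b, c, hab, hab₂, hac⟩ := key
  have h1 : ∀ v, F x y₁ v v = 0 := h.self_right x y₁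
  have h2 : ∀ v, F x y₂ v v = 0 := h.self_right x y₂
  have hba : F x y₁ b a = -1 := by rw [h.skew', hab]
  have hba₂ : F x y₂ b a = 0 := by rw [h.skew', hab₂, neg_zero]
  set s := F x y₁ a c with hs
  -- subtract multiples of `a` and `b` from `b` and `c`, in order to normalize the remaining values
  refine ⟨y₁, y₂, a, b - F x y₂ b c • a, c - s • b + F x y₁ b c • a, ?_, ?_, ?_, ?_, ?_, ?_⟩ <;>
  simp only [map_add, map_sub, map_smul, LinearMap.sub_apply,
    LinearMap.smul_apply, smul_eq_mul, h1, h2, hab, hab₂, hac, hba, hba₂, ← hs] <;> ring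

/-- For spacelike `x`, either the forms `F(x, ·)` have a common factor, or, on the contrary, they
are determined by their values on three pairs of vectors and have a common kernel vector. -/
lemma factor_or_kernel (h : IsSpacelikeRankTwo g F) (hn : HasPositiveIndex g n) (hn4 : 4 ≤ n)
    {x : V} (hx : 0 < g x x) :
    (∃ u, IsFactor F x u) ∨
      ((∃ a b c, ∀ y, F x y a b = 0 → F x y a c = 0 → F x y b c = 0 → F x y = 0) ∧
        ∃ m, m ≠ 0 ∧ ∀ y w, F x y m w = 0) := by
  obtain ⟨y₁, y₂, a, b, c, hab, hab₂, hac, hac₂, hbc, hbc₂⟩ :=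
    h.exists_dual_triple hn (by omega) hx
  have pl := h.plucker_right x
  have sk := h.skew' x
  have s0 := h.self_right x
  have hba : F x y₁ b a = -1 := by rw [sk, hab]
  have hba₂ : F x y₂ b a = 0 := by rw [sk, hab₂, neg_zero]
  have hca : F x y₁ c a = 0 := by rw [sk, hac, neg_zero]
  have hca₂ : F x y₂ c a = -1 := by rw [sk, hac₂]
  have hcb : F x y₁ c b = 0 := by rw [sk, hbc, neg_zero]
  have hcb₂ : F x y₂ c b = 0 := by rw [sk, hbc₂, neg_zero]
  -- the common factor of the two forms
  have hu (z : V) : F x y₂ c z = F x y₁ b z := by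
    have := pl y₁ y₂ a b c z
    simp only [hab, hab₂, hac, hac₂, hbc, hbc₂] at this
    linarith
  have hω₁ (z w : V) : F x y₁ z w = F x y₁ a z * F x y₁ b w - F x y₁ a w * F x y₁ b z := by
    have := pl y₁ y₁ a b z w
    simp only [hab] at this
    linarith
  have hω₂ (z w : V) : F x y₂ z w = F x y₂ a z * F x y₁ b w - F x y₂ a w * F x y₁ b z := by
    have := pl y₂ y₂ a c z w
    simp only [hac₂, hu] at this
    linarith
  by_cases h0 : ∀ y, F x y b c = 0
  · left
    refine ⟨F x y₁ b, fun hb => by simp [hb] at hba, fun y z w hz hw => ?_⟩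
    have hcw (w : V) (hw : F x y₁ b w = 0) : F x y c w = 0 := by
      have := pl y₁ y a b c w
      simp only [hab, hac, hbc, h0, hw, hω₁ c w] at this
      have hbc' : F x y b c = 0 := h0 y
      linarith
    have := pl y₂ y a c z w
    simp only [hac₂, hu, hw, hz, hω₂ z w, hcw w hw, hcw z hz] at this
    linarith
  · right
    push Not at h0
    obtain ⟨y₀, hy₀⟩ := h0
    refine ⟨⟨a, b, c, fun y h1 h2 h3 => ?_⟩, ?_⟩
    · have h1' : F x y b a = 0 := by rw [sk, h1, neg_zero]
      have h2' : F x y c a = 0 := by rw [sk, h2, neg_zero]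
      have h3' : F x y c b = 0 := by rw [sk, h3, neg_zero]
      have hc (w : V) : F x y c w = 0 := by
        have := pl y₁ y a b c w
        simp only [hab, hac, hbc, h1, h2, h3] at this
        linarith
      have hb (w : V) : F x y b w = 0 := by
        have := pl y₂ y a c b w
        simp only [hac₂, hab₂, hcb₂, h1, h2, h3'] at this
        linarith
      have ha (w : V) : F x y a w = 0 := by
        have := pl y₀ y b c a w
        simp only [h1', h2', h3, hc, hb, mul_zero, zero_mul] at this
        have : F x y₀ b c * F x y a w = 0 := by linarith
        simpa [hy₀] using this
      ext z w
      have := pl y₁ y a b z w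
      simp only [hab, ha, hb, mul_zero, zero_mul] at this
      simp only [LinearMap.zero_apply]
      linarith
    · obtain ⟨m, hm, hm1, hm2, hm3⟩ := hn.exists_pos₃ (by omega) (F x y₁ b) (F x y₁ a) (F x y₂ a)
      refine ⟨m, fun h0 => by simp [h0] at hm, ?_⟩
      have e1 (w : V) : F x y₁ m w = 0 := by rw [hω₁, hm1, hm2]; ring
      have e2 (w : V) : F x y₂ m w = 0 := by rw [hω₂, hm1, hm3]; ring
      have e3 (y w : V) : F x y m w = F x y a m * F x y₁ b w - F x y₁ a w * F x y b m := by
        have := pl y₁ y a b m w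
        simp only [hab, e1, hm1, hm2] at this
        linarith
      have e4 (y w : V) : F x y m w = F x y a m * F x y₁ b w - F x y₂ a w * F x y c m := by
        have := pl y₂ y a c m w
        simp only [hac₂, e2, hu, hm1, hm3] at this
        linarith
      have e5 (y : V) : F x y b m = 0 := by
        have h3 := e3 y b
        have h4 := e4 y b
        rw [hab] at h3
        rw [hab₂] at h4
        linarith
      have e6 (y : V) : F x y c m = 0 := by
        have h3 := e3 y c
        have h4 := e4 y c
        rw [hac] at h3
        rw [hac₂] at h4
        linarith
      have e9 : F x y₀ m a = 0 := by
        have := pl y₀ y₀ b c m a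
        simp only [e5, e6] at this
        have : F x y₀ b c * F x y₀ m a = 0 := by linarith
        simpa [hy₀] using this
      have e10 (y : V) : F x y m a = 0 := by
        have := pl y₀ y b c m a
        simp only [e5, e6, e9] at this
        have : F x y₀ b c * F x y m a = 0 := by linarith
        simpa [hy₀] using this
      intro y w
      rw [e3, sk y a, e10, e5]
      ring

/-- In index at least five, and for positive definite forms in dimension four, the forms `F(x, ·)`
have a common factor, unless the Jacobi operator of the spacelike vector `x` vanishes. -/
lemma factor_or_jacobi_eq_zero (h : IsSpacelikeRankTwo g F) (hn : HasPositiveIndex g n)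
    (hn' : 5 ≤ n ∨ 4 ≤ n ∧ ∀ v, v ≠ 0 → 0 < g v v) {x : V} (hx : 0 < g x x) :
    (∃ u, IsFactor F x u) ∨ ∀ y w, F x y x w = 0 := by
  obtain hu | ⟨⟨a, b, c, habc⟩, m, hm, hmk⟩ := h.factor_or_kernel hn (by omega) hx
  · exact Or.inl hu
  obtain h5 | ⟨-, hpos⟩ := hn'
  · exfalso
    obtain ⟨y, hy, hxy, h1, h2, h3⟩ := hn.exists_pos₄ (by omega) (g x) (((F x).flip a).flip b)
      (((F x).flip a).flip c) (((F x).flip b).flip c)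
    exact h.ne_zero x y hx hy hxy (habc y h1 h2 h3)
  · right
    have hxm : F x m = 0 := by
      ext y w
      have h1 := h.bianchi x m y w
      have h2 : F m y x w = 0 := by rw [h.pair, hmk]
      have h3 : F y x m w = 0 := by rw [h.skew, hmk, neg_zero]
      simpa [h2, h3] using h1
    -- hence the common kernel vector `m` is a multiple of `x`
    set s := g x m / g x x with hs
    have hm' : m - s • x = 0 := by
      by_contra hne
      refine h.ne_zero x _ hx (hpos _ hne) ?_ ?_
      · rw [map_sub, map_smul, smul_eq_mul, hs, div_mul_cancel₀ _ hx.ne', sub_self]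
      · have hxx : F x x = 0 := by ext; exact h.self_left _ _ _
        rw [map_sub, map_smul, hxm, hxx, smul_zero, sub_zero]
    rw [sub_eq_zero] at hm'
    intro y w
    have := hmk y w
    rw [hm', map_smul, LinearMap.smul_apply, smul_eq_mul, mul_eq_zero] at this
    refine this.resolve_left fun h0 => hm ?_
    rw [hm', h0, zero_smul]

/-- A linear form vanishing on a hyperplane is a multiple of the linear form defining it. -/
lemma _root_.LinearMap.apply_eq_mul_of_ker {u θ : V →ₗ[ℝ] ℝ} {v : V} (hv : u v = 1)
    (h : ∀ z, u z = 0 → θ z = 0) (z : V) : θ z = u z * θ v := by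
  have := h (z - u z • v) (by simp [hv])
  rw [map_sub, map_smul, smul_eq_mul] at this
  linarith

open Filter Topology in
/-- If every factor `u` of a spacelike `x` vanishes at `x`, then `F(x, y, y, ·) = 0` for `y` in
`ker u`. Otherwise the factors of the vectors `y` in an open subset of `ker u` would be multiples
of `u`, so that `F(z, w)` would vanish on `ker u` for all `z` and `w` in `ker u`. -/
lemma apply_self_eq_zero_of_factor (h : IsSpacelikeRankTwo g F) (hn : HasPositiveIndex g n)
    (hn' : 5 ≤ n ∨ 4 ≤ n ∧ ∀ v, v ≠ 0 → 0 < g v v)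
    (H : ∀ x u, 0 < g x x → IsFactor F x u → u x = 0)
    {x : V} (hx : 0 < g x x) {u : V →ₗ[ℝ] ℝ} (hu : IsFactor F x u) {y : V} (hy : u y = 0) (w : V) :
    F x y y w = 0 := by
  obtain ⟨v₀, hv₀⟩ := exists_apply_eq_one hu.1
  obtain ⟨y₁, hy₁, hxy₁, huy₁⟩ := hn.exists_pos₂ (by omega) (g x) u
  by_contra hne
  -- a spacelike vector at which the quadratic map does not vanish
  obtain ⟨y₂, hy₂, huy₂, hne₂⟩ : ∃ y₂, 0 < g y₂ y₂ ∧ u y₂ = 0 ∧ F x y₂ y₂ w ≠ 0 := by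
    by_contra! hcon
    apply hne
    apply quartic_coeff_eq_zero (c₀ := 0) (c₁ := 0) (c₂ := F x y₁ y₁ w)
      (c₃ := F x y₁ y w + F x y y₁ w)
    filter_upwards [eventually_pos y₁ y hy₁] with t ht
    have := hcon _ ht (by simp [hy, huy₁])
    simp only [map_add, map_smul, LinearMap.add_apply, LinearMap.smul_apply, smul_eq_mul] at this
    linear_combination t ^ 2 * this
  have hloc {y₃ : V} (hy₃ : 0 < g y₃ y₃) (huy₃ : u y₃ = 0) (hne₃ : F x y₃ y₃ w ≠ 0) (v z z' : V)
      (hz : u z = 0) (hz' : u z' = 0) : F y₃ v z z' = 0 := by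
    obtain ⟨u', hu'⟩ | hJ := h.factor_or_jacobi_eq_zero hn hn' hy₃
    · obtain ⟨v₁, hv₁⟩ := exists_apply_eq_one hu'.1
      have h1 := LinearMap.apply_eq_mul_of_ker (θ := F x y₃ y₃) hv₀
        fun z hz => hu.2 y₃ y₃ z huy₃ hz
      have h2 := LinearMap.apply_eq_mul_of_ker (θ := F x y₃ y₃) hv₁ fun z hz => by
        rw [h.skew, hu'.2 x y₃ z (H _ _ hy₃ hu') hz, neg_zero]
      have h3 : F x y₃ y₃ v₁ ≠ 0 := fun h0 => hne₃ (by rw [h2, h0, mul_zero])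
      have h4 (z : V) (hz : u z = 0) : u' z = 0 := by
        have := h2 z
        rw [h1, hz, zero_mul, eq_comm, mul_eq_zero] at this
        exact this.resolve_right h3
      exact hu'.2 v z z' (h4 z hz) (h4 z' hz')
    · exact absurd (by rw [h.skew, hJ, neg_zero]) hne₃
  have hall {z z' z'' : V} (hz : u z = 0) (hz' : u z' = 0) (hz'' : u z'' = 0) (v : V) :
      F z'' v z z' = 0 := by
    refine linearMap_eq_zero_of_eventually ((((F.flip v).flip z)).flip z') (y := y₂) ?_
    have hcont : Continuous fun t : ℝ => F x (y₂ + t • z'') (y₂ + t • z'') w := by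
      simp only [map_add, map_smul, LinearMap.add_apply, LinearMap.smul_apply, smul_eq_mul]
      fun_prop
    have hev : ∀ᶠ t in 𝓝 (0 : ℝ), F x (y₂ + t • z'') (y₂ + t • z'') w ≠ 0 :=
      hcont.continuousAt.eventually_ne (by simpa)
    filter_upwards [hev, eventually_pos y₂ z'' hy₂] with t h1 h2
    exact hloc h2 (by simp [huy₂, hz'']) h1 v z z' hz hz'
  refine h.ne_zero x y₁ hx hy₁ hxy₁ ?_
  have hux := H x u hx hu
  have h1 (z v : V) (hz : u z = 0) : F x y₁ z v = 0 := by
    rw [h.pair]; exact hall hux huy₁ hz v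
  have h2 (v : V) : F x y₁ v₀ v = 0 := by
    have := LinearMap.apply_eq_mul_of_ker (θ := F x y₁ v₀) hv₀
      (fun z hz => by rw [h.skew', h1 z v₀ hz, neg_zero]) v
    rw [this, h.self_right, mul_zero]
  ext z v
  have := LinearMap.apply_eq_mul_of_ker (θ := (F x y₁).flip v) hv₀ (fun z hz => h1 z v hz) z
  simpa [h2] using this

/-- Some spacelike vector `x` has a factor `u` with `u x ≠ 0`. -/
lemma exists_factor_apply_ne_zero (h : IsSpacelikeRankTwo g F) (hn : HasPositiveIndex g n)
    (hn' : 5 ≤ n ∨ 4 ≤ n ∧ ∀ v, v ≠ 0 → 0 < g v v) :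
    ∃ x u, 0 < g x x ∧ IsFactor F x u ∧ u x ≠ 0 := by
  by_contra! H
  obtain ⟨x₀, hx₀⟩ := hn.exists_pos₀ (by omega)
  obtain ⟨x, u, hx, hu⟩ : ∃ x u, 0 < g x x ∧ IsFactor F x u := by
    by_contra! hcon
    have hJ (x y w : V) : F x y x w = 0 := by
      refine apply_self_eq_zero_of_spacelike ((F.flip y).compr₂ (LinearMap.applyₗ w)) hx₀
        (fun x hx => ?_) x
      obtain ⟨u, hu⟩ | hJ := h.factor_or_jacobi_eq_zero hn hn' hx
      · exact absurd hu (hcon x u hx)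
      · simpa using hJ y w
    obtain ⟨y₀, hy₀, hxy₀⟩ := hn.exists_pos₁ (by omega) (g x₀)
    refine h.ne_zero x₀ y₀ hx₀ hy₀ hxy₀ ?_
    have hsk (x y z w : V) : F x y z w = -F z y x w := by
      have := hJ (x + z) y w
      simp only [map_add, LinearMap.add_apply, hJ] at this
      linarith
    ext z w
    have h1 := h.bianchi x₀ y₀ z w
    have h2 := hsk y₀ z x₀ w
    have h3 := hsk z x₀ y₀ w
    have h4 := h.skew x₀ z y₀ w
    have h5 := h.skew y₀ x₀ z w
    have h6 := hsk x₀ y₀ z w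
    have h7 := h.skew z y₀ x₀ w
    simp only [LinearMap.zero_apply]
    linarith
  have hux := H x u hx hu
  have h0 {y : V} (hy : u y = 0) (w : V) : F x y y w = 0 :=
    h.apply_self_eq_zero_of_factor hn hn' H hx hu hy w
  obtain ⟨v₀, hv₀⟩ := exists_apply_eq_one hu.1
  obtain ⟨y₁, hy₁, hxy₁, huy₁⟩ := hn.exists_pos₂ (by omega) (g x) u
  refine h.ne_zero x y₁ hx hy₁ hxy₁ ?_
  have h1 (z w : V) (hz : u z = 0) : F x y₁ z w = 0 := by
    have e1 := h0 (y := y₁ + z) (by simp [hz, huy₁]) w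
    simp only [map_add, LinearMap.add_apply, h0 huy₁, h0 hz] at e1
    have e2 := h.bianchi x y₁ z w
    have e3 : F y₁ z x w = 0 := by rw [h.pair, hu.2 w y₁ z huy₁ hz]
    have e4 := h.skew z x y₁ w
    linarith
  have h2 (v : V) : F x y₁ v₀ v = 0 := by
    have := LinearMap.apply_eq_mul_of_ker (θ := F x y₁ v₀) hv₀
      (fun z hz => by rw [h.skew', h1 z v₀ hz, neg_zero]) v
    rw [this, h.self_right, mul_zero]
  ext z v
  have := LinearMap.apply_eq_mul_of_ker (θ := (F x y₁).flip v) hv₀ (fun z hz => h1 z v hz) z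
  simpa [h2] using this

end IsSpacelikeRankTwo
end CommonFactor

/-! ### The curvature tensor of a symmetric bilinear form -/

section Wedge

variable {V : Type*}

/-- The wedge product of a one-form and a two-form vanishes. -/
def WedgeZero (β : V → ℝ) (δ : V → V → ℝ) : Prop :=
  ∀ a b c, β a * δ b c - β b * δ a c + β c * δ a b = 0

lemma WedgeZero.apply_eq {β : V → ℝ} {δ : V → V → ℝ} (h : WedgeZero β δ) {a : V} (ha : β a = 1)
    (b c : V) : δ b c = β b * δ a c - β c * δ a b := by
  have := h a b c
  rw [ha] at this
  linarith

/-- A two-form with two independent factors is determined by one value. -/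
lemma WedgeZero.eq_zero_of_two {β₁ β₂ : V → ℝ} {δ : V → V → ℝ} (hδ : ∀ a b, δ a b = -δ b a)
    {b₁ b₂ : V} (h₁ : WedgeZero β₁ δ) (h₂ : WedgeZero β₂ δ) (h11 : β₁ b₁ = 1) (h21 : β₂ b₁ = 0)
    (h22 : β₂ b₂ = 1) (h0 : δ b₁ b₂ = 0) (a b : V) : δ a b = 0 := by
  have h0' : δ b₂ b₁ = 0 := by rw [hδ, h0, neg_zero]
  have e (c : V) : δ b₁ c = 0 := by rw [h₂.apply_eq h22, h21, h0']; ring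
  rw [h₁.apply_eq h11, e, e]
  ring

/-- A two-form with three independent factors vanishes. -/
lemma WedgeZero.eq_zero_of_three {β₁ β₂ β₃ : V → ℝ} {δ : V → V → ℝ} (hδ : ∀ a b, δ a b = -δ b a)
    {b₁ b₂ b₃ : V} (h₁ : WedgeZero β₁ δ) (h₂ : WedgeZero β₂ δ) (h₃ : WedgeZero β₃ δ)
    (h11 : β₁ b₁ = 1) (h21 : β₂ b₁ = 0) (h22 : β₂ b₂ = 1) (h31 : β₃ b₁ = 0) (h32 : β₃ b₂ = 0)
    (h33 : β₃ b₃ = 1) (a b : V) : δ a b = 0 := by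
  refine WedgeZero.eq_zero_of_two hδ h₁ h₂ h11 h21 h22 ?_ a b
  rw [h₃.apply_eq h33, h31, h32]
  ring

/-- A tensor `D`, alternating in both pairs of variables and such that `B(y, ·)` is a factor of
`D(y, z)` for all `y` and `z`, vanishes if it vanishes at one suitable place and `B` has rank at
least three. -/
lemma eq_zero_of_wedgeZero [Add V] {B : V → V → ℝ} {D : V → V → V → V → ℝ}
    (hB : ∀ y y' a, B (y + y') a = B y a + B y' a)
    (hD : ∀ y y' z a b, D (y + y') z a b = D y z a b + D y' z a b)
    (hsk : ∀ y z a b, D y z a b = -D z y a b) (hsk' : ∀ y z a b, D y z a b = -D y z b a)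
    (hw : ∀ y z, WedgeZero (B y) (D y z)) {y₁ y₂ y₃ b₁ b₂ b₃ : V}
    (h11 : B y₁ b₁ = 1) (h21 : B y₂ b₁ = 0) (h22 : B y₂ b₂ = 1)
    (h31 : B y₃ b₁ = 0) (h32 : B y₃ b₂ = 0) (h33 : B y₃ b₃ = 1)
    (h0 : D y₁ y₂ b₁ b₂ = 0) (y z a b : V) : D y z a b = 0 := by
  have hneg (y z : V) (β : V → ℝ) (h : WedgeZero β (D z y)) : WedgeZero β (D y z) := by
    intro a b c
    have := h a b c
    rw [hsk y z, hsk y z, hsk y z]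
    linarith
  -- the polarization of `hw`
  have hpol (y y' z : V) (h : ∀ a b, D y' z a b = 0) : WedgeZero (B y') (D y z) := by
    intro a b c
    have e1 := hw (y + y') z a b c
    simp only [hB, hD, h] at e1
    have e2 := hw y z a b c
    linarith
  have three {y z : V} (e₁ : WedgeZero (B y₁) (D y z)) (e₂ : WedgeZero (B y₂) (D y z))
      (e₃ : WedgeZero (B y₃) (D y z)) : ∀ a b, D y z a b = 0 :=
    WedgeZero.eq_zero_of_three (hsk' y z) e₁ e₂ e₃ h11 h21 h22 h31 h32 h33
  have sw {y z : V} (e : ∀ a b, D y z a b = 0) (a b : V) : D z y a b = 0 := by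
    rw [hsk, e, neg_zero]
  have d12 : ∀ a b, D y₁ y₂ a b = 0 :=
    WedgeZero.eq_zero_of_two (hsk' _ _) (hw _ _) (hneg _ _ _ (hw _ _)) h11 h21 h22 h0
  have d13 : ∀ a b, D y₁ y₃ a b = 0 :=
    three (hw _ _) (hneg _ _ _ (hpol _ _ _ (sw d12))) (hneg _ _ _ (hw _ _))
  have d23 : ∀ a b, D y₂ y₃ a b = 0 :=
    three (hneg _ _ _ (hpol _ _ _ d12)) (hw _ _) (hneg _ _ _ (hw _ _))
  have d1 (y : V) : ∀ a b, D y y₁ a b = 0 :=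
    three (hneg _ _ _ (hw _ _)) (hpol _ _ _ (sw d12)) (hpol _ _ _ (sw d13))
  have d2 (y : V) : ∀ a b, D y y₂ a b = 0 :=
    three (hpol _ _ _ d12) (hneg _ _ _ (hw _ _)) (hpol _ _ _ (sw d23))
  have d3 (y : V) : ∀ a b, D y y₃ a b = 0 :=
    three (hpol _ _ _ d13) (hpol _ _ _ d23) (hneg _ _ _ (hw _ _))
  exact three (hpol _ _ _ (sw (d1 z))) (hpol _ _ _ (sw (d2 z))) (hpol _ _ _ (sw (d3 z))) a b

end Wedge

section Classification

variable {V : Type*} [AddCommGroup V] [Module ℝ V] {g : LinearMap.BilinForm ℝ V}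
  {F : V →ₗ[ℝ] V →ₗ[ℝ] V →ₗ[ℝ] V →ₗ[ℝ] ℝ} {n : ℕ}

/-- A curvature tensor of spacelike rank two is, up to a factor, the curvature tensor
`φ(x, w) φ(y, z) - φ(x, z) φ(y, w)` of a symmetric bilinear form `φ`. -/
theorem IsSpacelikeRankTwo.exists_form (h : IsSpacelikeRankTwo g F) (hn : HasPositiveIndex g n)
    (hn' : 5 ≤ n ∨ 4 ≤ n ∧ ∀ v, v ≠ 0 → 0 < g v v) :
    ∃ (C : ℝ) (φ : LinearMap.BilinForm ℝ V), (∀ x y, φ x y = φ y x) ∧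
      ∀ x y z w, F x y z w = C * (φ x w * φ y z - φ x z * φ y w) := by
  obtain ⟨x₀, u', hx₀, hu', hux'⟩ := h.exists_factor_apply_ne_zero hn hn'
  -- normalize the factor
  obtain ⟨u, hu, hux⟩ : ∃ u : V →ₗ[ℝ] ℝ,
      (∀ y z w, u z = 0 → u w = 0 → F x₀ y z w = 0) ∧ u x₀ = 1 := by
    refine ⟨(u' x₀)⁻¹ • u', fun y z w hz hw => hu'.2 y z w ?_ ?_, by simp [hux']⟩
    · simpa [hux'] using hz
    · simpa [hux'] using hw
  set B : LinearMap.BilinForm ℝ V := (F x₀).compr₂ (LinearMap.applyₗ x₀) with hBdef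
  have hB (y z : V) : B y z = F x₀ y z x₀ := rfl
  have hBs (y z : V) : B y z = B z y := by rw [hB, hB, h.pair, h.skew, h.skew', neg_neg]
  have hB0 (z : V) : B x₀ z = 0 := h.self_left _ _ _
  have hB0' (z : V) : B z x₀ = 0 := by rw [hBs, hB0]
  set P : V →ₗ[ℝ] V := LinearMap.id - u.smulRight x₀ with hPdef
  have hP (v : V) : v = P v + u v • x₀ := by simp [hPdef]
  have huP (v : V) : u (P v) = 0 := by simp [hPdef, hux]
  have hBP (y z : V) : B (P y) (P z) = B y z := by
    conv_rhs => rw [hP y, hP z]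
    simp [hB0, hB0']
  -- `F(x₀, y)` is the wedge product of `u` and `B(y, ·)`
  have hFx (y z w : V) : F x₀ y z w = u w * B y z - u z * B y w := by
    have h1 (z w : V) : F x₀ y (P z) w = u w * B y (P z) := by
      conv_lhs => rw [hP w]
      simp [hu y (P z) (P w) (huP z) (huP w), hB]
    have h2 (z : V) : B y (P z) = B y z := by
      conv_rhs => rw [hP z]
      simp [hB0']
    conv_lhs => rw [hP z]
    simp only [map_add, map_smul, LinearMap.add_apply, LinearMap.smul_apply, smul_eq_mul, h1, h2]
    rw [h.skew', ← hB]
    ring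
  have hF0 (y z w : V) (hy : u y = 0) (hz : u z = 0) : F y z x₀ w = 0 := by
    rw [h.pair, hFx, hy, hz]; ring
  have hB_ne (y : V) (hy : 0 < g y y) (hxy : g x₀ y = 0) : B y ≠ 0 := by
    intro h0
    refine h.ne_zero x₀ y hx₀ hy hxy ?_
    ext z w
    simp [hFx, h0]
  -- the matrix of the `B(yᵢ, bⱼ)` is triangular; so `B` has rank at least three
  obtain ⟨y₁, hy₁, hxy₁⟩ := hn.exists_pos₁ (by omega) (g x₀)
  obtain ⟨b₁, h11⟩ := exists_apply_eq_one (hB_ne y₁ hy₁ hxy₁)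
  obtain ⟨y₂, hy₂, hxy₂, h21⟩ := hn.exists_pos₂ (by omega) (g x₀) (LinearMap.flip B b₁)
  obtain ⟨b₂, h22⟩ := exists_apply_eq_one (hB_ne y₂ hy₂ hxy₂)
  obtain ⟨y₃, hy₃, hxy₃, h31, h32⟩ := hn.exists_pos₃ (by omega) (g x₀) (LinearMap.flip B b₁)
    (LinearMap.flip B b₂)
  obtain ⟨b₃, h33⟩ := exists_apply_eq_one (hB_ne y₃ hy₃ hxy₃)
  rw [LinearMap.flip_apply] at h21 h31 h32
  set κ := F (P y₁) (P y₂) (P b₁) (P b₂) with hκ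
  -- the restriction of `F` to `ker u` is a multiple of the curvature tensor of `B`
  have hker (y z a b : V) :
      F (P y) (P z) (P a) (P b) = κ * (B y a * B z b - B y b * B z a) := by
    have hw (y z : V) :
        WedgeZero (B y) (fun a b => F (P y) (P z) (P a) (P b)) := by
      intro a b c
      have := h.plucker_left x₀ (P z) (P y) x₀ (P a) (P b) (P c)
      simp only [hFx, huP, hux, hBP, h.skew (P z) (P y), hF0 _ _ _ (huP y) (huP z)] at this
      linarith
    have := eq_zero_of_wedgeZero (B := fun y z => B y z)
      (D := fun y z a b => F (P y) (P z) (P a) (P b) - κ * (B y a * B z b - B y b * B z a))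
      (fun y y' a => by simp) (fun y y' z a b => by simp; ring)
      (fun y z a b => by simp only [h.skew (P y) (P z)]; ring)
      (fun y z a b => by simp only [h.skew' _ _ (P a) (P b)]; ring)
      (fun y z a b c => by have := hw y z a b c; simp only at this ⊢; linear_combination this)
      h11 h21 h22 h31 h32 h33
      (by simp only [h11, h22, h21, ← hκ]; ring) y z a b
    linarith
  have hFall (y z a b : V) : F y z a b = κ * (B y a * B z b - B y b * B z a) +
      u y * (u b * B z a - u a * B z b) - u z * (u b * B y a - u a * B y b) := by
    have e1 (y z a b : V) (hy : u y = 0) (hz : u z = 0) : F y z a b = F y z (P a) (P b) := by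
      conv_lhs => rw [hP a, hP b]
      simp [hF0 y z _ hy hz, h.skew' y z _ x₀]
    have e2 : F y z a b = F (P y) (P z) a b + u y * F x₀ z a b - u z * F x₀ (P y) a b := by
      have e0 : F x₀ z a b = F x₀ (P z) a b := by
        conv_lhs => rw [hP z]
        simp [h.self_left x₀]
      rw [e0]
      conv_lhs => rw [hP y, hP z]
      simp [h.skew (P y) x₀, h.self_left x₀]
      ring
    have e3 (z : V) : B (P y) z = B y z := by
      conv_rhs => rw [hP y]
      simp [hB0]
    rw [e2, e1 _ _ _ _ (huP y) (huP z), hker, hFx, hFx, e3, e3]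
  have hκ0 : κ ≠ 0 := by
    intro h0
    obtain ⟨y, hy, huy⟩ := hn.exists_pos₁ (by omega) u
    obtain ⟨z, hz, hyz, huz⟩ := hn.exists_pos₂ (by omega) (g y) u
    refine h.ne_zero y z hy hz hyz ?_
    ext a b
    simp [hFall, h0, huy, huz]
  refine ⟨-κ⁻¹, u.smulRight u - κ • B, fun x y => ?_, fun x y z w => ?_⟩
  · simp [hBs x y, mul_comm]
  · rw [hFall]
    simp only [LinearMap.sub_apply, LinearMap.smulRight_apply, LinearMap.smul_apply, smul_eq_mul]
    field_simp
    ring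

end Classification

/-! ### Orthonormal bases and the rank of curvature operators -/

section Orthonormal

open Filter Topology

variable {V : Type*} [AddCommGroup V] [Module ℝ V] {g : LinearMap.BilinForm ℝ V}

lemma Causal.sign_mul_self (ε : Causal) : ε.sign * ε.sign = 1 := by
  cases ε <;> simp [Causal.sign]

lemma Causal.sign_ne_zero (ε : Causal) : ε.sign ≠ 0 := by
  cases ε <;> simp [Causal.sign]

lemma apply_sum_of_orthonormal {ε : Causal} {k : ℕ} {e : Fin k → V}
    (he : ∀ i j, g (e i) (e j) = if i = j then ε.sign else 0) (c : Fin k → ℝ) (j : Fin k) :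
    g (∑ i, c i • e i) (e j) = c j * ε.sign := by
  simp [he]

lemma linearIndependent_of_orthonormal {ε : Causal} {k : ℕ} {e : Fin k → V}
    (he : ∀ i j, g (e i) (e j) = if i = j then ε.sign else 0) : LinearIndependent ℝ e := by
  rw [Fintype.linearIndependent_iff]
  intro c hc j
  have := apply_sum_of_orthonormal he c j
  rw [hc] at this
  simpa [ε.sign_ne_zero] using this

/-- Orthonormal families span planes of the Grassmannian. -/
lemma span_mem_Gr {ε : Causal} {k : ℕ} {e : Fin k → V}
    (he : ∀ i j, g (e i) (e j) = if i = j then ε.sign else 0) :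
    Submodule.span ℝ (Set.range e) ∈ Gr g ε k := by
  refine ⟨FiniteDimensional.span_of_finite ℝ (Set.finite_range e), ?_, fun x hx hx0 => ?_⟩
  · rw [finrank_span_eq_card (linearIndependent_of_orthonormal he), Fintype.card_fin]
  · obtain ⟨c, rfl⟩ := (Submodule.mem_span_range_iff_exists_fun ℝ).1 hx
    have h1 : ε.sign * g (∑ i, c i • e i) (∑ i, c i • e i) = ∑ i, c i ^ 2 := by
      conv_lhs => rw [map_sum (g (∑ i, c i • e i)), Finset.mul_sum]
      refine Finset.sum_congr rfl fun j _ => ?_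
      rw [map_smul, apply_sum_of_orthonormal he, smul_eq_mul]
      linear_combination c j ^ 2 * ε.sign_mul_self
    rw [h1]
    have hne : c ≠ 0 := by
      rintro rfl
      simp at hx0
    obtain ⟨j, hj⟩ := Function.ne_iff.1 hne
    exact Finset.sum_pos' (fun i _ => sq_nonneg _) ⟨j, Finset.mem_univ _, by
      have : c j ≠ 0 := hj
      positivity⟩

lemma orthonormal_pair (hg : ∀ x y, g x y = g y x) {x y : V} (hx : g x x = 1) (hy : g y y = 1)
    (hxy : g x y = 0) (i j : Fin 2) :
    g (![x, y] i) (![x, y] j) = if i = j then Causal.spacelike.sign else 0 := by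
  fin_cases i <;> fin_cases j <;> simp [hx, hy, hxy, hg y x, Causal.sign]

/-- The Gram-Schmidt process for two vectors. -/
lemma exists_gramSchmidt (hg : ∀ x y, g x y = g y x) {x y : V} (hx : 0 < g x x)
    (hxy : 0 < gramDet g x y) :
    ∃ (e f : V) (α β γ : ℝ), g e e = 1 ∧ g f f = 1 ∧ g e f = 0 ∧ α ≠ 0 ∧ γ ≠ 0 ∧ x = α • e ∧
      y = β • e + γ • f := by
  set α := √(g x x) with hα
  have hα0 : 0 < α := Real.sqrt_pos.2 hx
  have hα2 : α * α = g x x := Real.mul_self_sqrt hx.le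
  set z := y - (g x y / g x x) • x with hz
  have hxz : g x z = 0 := by
    rw [hz, map_sub, map_smul, smul_eq_mul, div_mul_cancel₀ _ hx.ne', sub_self]
  have hzz : 0 < g z z := by
    have : g z z = gramDet g x y / g x x := by
      rw [hz]
      simp only [gramDet, map_sub, map_smul, LinearMap.sub_apply, LinearMap.smul_apply,
        smul_eq_mul, hg y x]
      field_simp
      ring
    rw [this]
    positivity
  set γ := √(g z z) with hγ
  have hγ0 : 0 < γ := Real.sqrt_pos.2 hzz
  have hγ2 : γ * γ = g z z := Real.mul_self_sqrt hzz.le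
  refine ⟨α⁻¹ • x, γ⁻¹ • z, α, g x y / g x x * α, γ, ?_, ?_, ?_, hα0.ne', hγ0.ne', ?_, ?_⟩
  · simp only [map_smul, LinearMap.smul_apply, smul_eq_mul, ← hα2]
    field_simp
  · simp only [map_smul, LinearMap.smul_apply, smul_eq_mul, ← hγ2]
    field_simp
  · simp [hxz]
  · rw [smul_inv_smul₀ hα0.ne']
  · rw [smul_inv_smul₀ hγ0.ne', mul_smul, smul_inv_smul₀ hα0.ne', hz]
    abel

lemma gramDet_smul_add (b : LinearMap.BilinForm ℝ V) (e f : V) (α β γ : ℝ) :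
    gramDet b (α • e) (β • e + γ • f) = (α * γ) ^ 2 * gramDet b e f := by
  simp only [gramDet, map_add, map_smul, LinearMap.add_apply, LinearMap.smul_apply, smul_eq_mul]
  ring

/-- The four-linear form `g(R(x, y) z, w)`. -/
def curvatureForm (g : LinearMap.BilinForm ℝ V) (R : V →ₗ[ℝ] V →ₗ[ℝ] Module.End ℝ V) :
    V →ₗ[ℝ] V →ₗ[ℝ] V →ₗ[ℝ] V →ₗ[ℝ] ℝ :=
  R.compr₂ (LinearMap.llcomp ℝ V V (V →ₗ[ℝ] ℝ) g)

@[simp] lemma curvatureForm_apply (R : V →ₗ[ℝ] V →ₗ[ℝ] Module.End ℝ V) (x y z w : V) :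
    curvatureForm g R x y z w = g (R x y z) w := rfl

/-- A skew-symmetric operator of rank two is decomposable. -/
lemma pluckerRel_of_finrank_range (A : Module.End ℝ V)
    (hA : Module.finrank ℝ (LinearMap.range A) = 2) (θ : V →ₗ[ℝ] V →ₗ[ℝ] ℝ)
    (hθ : ∀ z, θ z = g (A z)) (hsk : ∀ z w, θ z w = -θ w z) : PluckerRel θ θ := by
  intro a b c d
  have hfin : FiniteDimensional ℝ (LinearMap.range A) :=
    FiniteDimensional.of_finrank_pos (by omega)
  have hker : LinearMap.ker (A.rangeRestrict ∘ₗ Fintype.linearCombination ℝ ![a, b, c]) ≠ ⊥ := by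
    apply LinearMap.ker_ne_bot_of_finrank_lt
    simp [hA]
  obtain ⟨s, hs, hs0⟩ := Submodule.exists_mem_ne_zero_of_ne_bot hker
  have hs' : s 0 • A a + s 1 • A b + s 2 • A c = 0 := by
    have := congrArg Subtype.val (LinearMap.mem_ker.1 hs)
    simpa [Fintype.linearCombination_apply, Fin.sum_univ_three] using this
  have hE (w : V) : s 0 * θ a w + s 1 * θ b w + s 2 * θ c w = 0 := by
    have := congrArg (fun v => g v w) hs'
    simpa [hθ] using this
  have h0 (z : V) : θ z z = 0 := by linarith [hsk z z]
  have ha := hE a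
  have hb := hE b
  have hc := hE c
  have hd := hE d
  rw [h0, hsk b a, hsk c a] at ha
  rw [h0, hsk c b] at hb
  rw [h0] at hc
  set pf := θ a b * θ c d - θ a c * θ b d + θ a d * θ b c with hpf
  have h0 : s 0 * pf = 0 := by
    linear_combination θ b c * hd + θ c d * hb - θ b d * hc
  have h1 : s 1 * pf = 0 := by
    linear_combination -θ a c * hd - θ c d * ha + θ a d * hc
  have h2 : s 2 * pf = 0 := by
    linear_combination θ a b * hd + θ b d * ha - θ a d * hb
  have hpf0 : pf = 0 := by
    by_contra hne
    apply hs0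
    ext i
    fin_cases i
    · simpa [hne] using h0
    · simpa [hne] using h1
    · simpa [hne] using h2
  linear_combination 2 * hpf0

/-- A function of two vectors, quadratic in each of them, vanishes if it vanishes whenever the
vectors span a spacelike plane. -/
lemma eq_zero_of_spacelike_pairs {n : ℕ} (hn : HasPositiveIndex g n) (hn2 : 2 ≤ n)
    (K : V → V → ℝ) (K₁ K₂ : V → V → V → ℝ)
    (hK₁ : ∀ x y y' (t : ℝ), K x (y + t • y') = K x y + K₁ x y y' * t + K x y' * t ^ 2)
    (hK₂ : ∀ x x' y (t : ℝ), K (x + t • x') y = K x y + K₂ x x' y * t + K x' y * t ^ 2)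
    (h : ∀ x y, 0 < g x x → 0 < gramDet g x y → K x y = 0) (x y : V) : K x y = 0 := by
  have h1 (x y : V) (hx : 0 < g x x) : K x y = 0 := by
    obtain ⟨y₁, hy₁, hxy₁⟩ := hn.exists_pos₁ (by omega) (g x)
    have hdet : 0 < gramDet g x y₁ := by simpa [gramDet, hxy₁] using mul_pos hx hy₁
    apply quartic_coeff_eq_zero (c₀ := 0) (c₁ := 0) (c₂ := K x y₁) (c₃ := K₁ x y₁ y)
    filter_upwards [eventually_gramDet_pos x y₁ 0 y hdet] with t ht
    rw [smul_zero, add_zero] at ht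
    have := h x _ hx ht
    rw [hK₁] at this
    linear_combination t ^ 2 * this
  obtain ⟨x₁, hx₁⟩ := hn.exists_pos₀ (by omega)
  apply quartic_coeff_eq_zero (c₀ := 0) (c₁ := 0) (c₂ := K x₁ y) (c₃ := K₂ x₁ x y)
  filter_upwards [eventually_pos x₁ x hx₁] with t ht
  have := h1 _ y ht
  rw [hK₂] at this
  linear_combination t ^ 2 * this

variable {R : V →ₗ[ℝ] V →ₗ[ℝ] Module.End ℝ V}

/-- Constant spacelike rank two, in terms of the curvature tensor. -/
lemma isSpacelikeRankTwo_of_hasConstantRank {n : ℕ} (hg : ∀ x y, g x y = g y x)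
    (hnd : g.Nondegenerate) (hn : HasPositiveIndex g n) (hn2 : 2 ≤ n)
    (hF : IsCurvatureTensor (curvatureForm g R))
    (hR : HasConstantRank g (fun x y => R x y) .spacelike 2) :
    IsSpacelikeRankTwo g (curvatureForm g R) := by
  have hrank (e f : V) (he : g e e = 1) (hf : g f f = 1) (hef : g e f = 0) :
      Module.finrank ℝ (LinearMap.range (R e f)) = 2 :=
    hR _ (span_mem_Gr (orthonormal_pair hg he hf hef)) ![e, f]
      ⟨orthonormal_pair hg he hf hef, rfl⟩
  have hscale (e f : V) (α β γ : ℝ) (z w : V) :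
      curvatureForm g R (α • e) (β • e + γ • f) z w = α * γ * curvatureForm g R e f z w := by
    simp only [map_add, map_smul, LinearMap.smul_apply, LinearMap.add_apply, hF.self_left,
      smul_eq_mul]
    ring
  refine { hF with symm := hg, plucker := fun x y => ?_, ne_zero := fun x y hx hy hxy h0 => ?_ }
  · intro a b c d
    have := eq_zero_of_spacelike_pairs hn hn2
      (fun x y => curvatureForm g R x y a b * curvatureForm g R x y c d -
        curvatureForm g R x y a c * curvatureForm g R x y b d +
        curvatureForm g R x y a d * curvatureForm g R x y b c)
      (fun x y y' => curvatureForm g R x y a b * curvatureForm g R x y' c d +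
        curvatureForm g R x y' a b * curvatureForm g R x y c d -
        curvatureForm g R x y a c * curvatureForm g R x y' b d -
        curvatureForm g R x y' a c * curvatureForm g R x y b d +
        curvatureForm g R x y a d * curvatureForm g R x y' b c +
        curvatureForm g R x y' a d * curvatureForm g R x y b c)
      (fun x x' y => curvatureForm g R x y a b * curvatureForm g R x' y c d +
        curvatureForm g R x' y a b * curvatureForm g R x y c d -
        curvatureForm g R x y a c * curvatureForm g R x' y b d -
        curvatureForm g R x' y a c * curvatureForm g R x y b d +
        curvatureForm g R x y a d * curvatureForm g R x' y b c +
        curvatureForm g R x' y a d * curvatureForm g R x y b c)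
      (fun x y y' t => by
        simp only [map_add, map_smul, LinearMap.add_apply, LinearMap.smul_apply, smul_eq_mul]
        ring)
      (fun x x' y t => by
        simp only [map_add, map_smul, LinearMap.add_apply, LinearMap.smul_apply, smul_eq_mul]
        ring)
      (fun x y hx hxy => by
        obtain ⟨e, f, α, β, γ, he, hf, hef, -, -, rfl, rfl⟩ := exists_gramSchmidt hg hx hxy
        have := pluckerRel_of_finrank_range (R e f) (hrank e f he hf hef)
          (curvatureForm g R e f) (fun z => rfl) (hF.skew' e f) a b c d
        simp only [hscale]
        linear_combination (α * γ) ^ 2 / 2 * this) x y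
    linear_combination 2 * this
  · have hdet : 0 < gramDet g x y := by simpa [gramDet, hxy] using mul_pos hx hy
    obtain ⟨e, f, α, β, γ, he, hf, hef, hα, hγ, rfl, rfl⟩ := exists_gramSchmidt hg hx hdet
    have hzero : R e f = 0 := by
      ext z
      refine hnd.1 _ fun w => ?_
      have := hscale e f α β γ z w
      rw [h0] at this
      simpa [hα, hγ] using this
    have := hrank e f he hf hef
    rw [hzero, LinearMap.range_zero, finrank_bot] at this
    omega

end Orthonormal

/-! ### The square of the symmetric operator -/

section Square

variable {V : Type*} [AddCommGroup V] [Module ℝ V] {g : LinearMap.BilinForm ℝ V} {n : ℕ}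

/-- Symmetric bilinear forms `H` and `g` with `Λ²H = d Λ²g` as quadratic functions satisfy
`Λ²H = d Λ²g` as bilinear forms. -/
lemma wedge_eq_of_gramDet_eq {H : LinearMap.BilinForm ℝ V} {d : ℝ} (hg : ∀ x y, g x y = g y x)
    (hH : ∀ x y, H x y = H y x) (h : ∀ x y, gramDet H x y = d * gramDet g x y) (x y z w : V) :
    H x z * H y w - H x w * H y z = d * (g x z * g y w - g x w * g y z) := by
  simp only [gramDet] at h
  have h1 (x y w : V) : H x x * H y w - H x w * H y x = d * (g x x * g y w - g x w * g y x) := by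
    have e := h x (y + w)
    have e₁ := h x y
    have e₂ := h x w
    simp only [map_add, LinearMap.add_apply, hH w y, hg w y, hH y x, hg y x, hH w x, hg w x]
      at e e₁ e₂ ⊢
    linear_combination (e - e₁ - e₂) / 2
  have h2 (x y z w : V) : H x z * H y w - H x w * H y z + (H z x * H y w - H z w * H y x) =
      d * (g x z * g y w - g x w * g y z + (g z x * g y w - g z w * g y x)) := by
    have e := h1 (x + z) y w
    simp only [map_add, LinearMap.add_apply] at e
    linear_combination e - h1 x y w - h1 z y w
  have a₁ := h2 x y z w
  have a₂ := h2 z x y w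
  simp only [hH z x, hg z x, hH y x, hg y x, hH z y, hg z y] at a₁ a₂ ⊢
  linear_combination (a₁ - a₂) / 3

/-- If orthogonality to spacelike vectors with respect to `g` implies orthogonality with respect to
`H`, then `H` is a multiple of `g`. -/
lemma exists_eq_mul_of_orthogonal {H : LinearMap.BilinForm ℝ V} (hg : ∀ x y, g x y = g y x)
    (hH : ∀ x y, H x y = H y x) {x₀ : V} (hx₀ : 0 < g x₀ x₀)
    (h : ∀ x w, 0 < g x x → g x w = 0 → H x w = 0) : ∃ r : ℝ, ∀ x y, H x y = r * g x y := by
  set r := H x₀ x₀ / g x₀ x₀ with hr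
  have hr' : H x₀ x₀ = r * g x₀ x₀ := by rw [hr, div_mul_cancel₀ _ hx₀.ne']
  have hP (v : V) : ∃ (s : ℝ) (w : V), v = s • x₀ + w ∧ g x₀ w = 0 := by
    refine ⟨g x₀ v / g x₀ x₀, v - (g x₀ v / g x₀ x₀) • x₀, by abel, ?_⟩
    rw [map_sub, map_smul, smul_eq_mul, div_mul_cancel₀ _ hx₀.ne', sub_self]
  have hself (v : V) : H v v = r * g v v := by
    obtain ⟨s, w, rfl, hw⟩ := hP v
    have hHw := h x₀ w hx₀ hw
    have hww : H w w = r * g w w := by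
      obtain ⟨t, ht, hpos⟩ := exists_ne_zero_of_eventually (eventually_pos x₀ w hx₀)
      have := h _ ((t * g w w) • x₀ - g x₀ x₀ • w) hpos (by
        simp only [map_add, map_sub, map_smul, LinearMap.add_apply, LinearMap.smul_apply,
          smul_eq_mul, hw, hg w x₀]
        ring)
      simp only [map_add, map_sub, map_smul, LinearMap.add_apply, LinearMap.smul_apply,
          smul_eq_mul, hHw, hH w x₀, hr'] at this
      have h2 : t * g x₀ x₀ * (r * g w w - H w w) = 0 := by linear_combination this
      have h3 : t * g x₀ x₀ ≠ 0 := mul_ne_zero ht hx₀.ne'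
      have := (mul_eq_zero.1 h2).resolve_left h3
      linarith
    simp only [map_add, map_smul, LinearMap.add_apply, LinearMap.smul_apply, smul_eq_mul, hw,
      hg w x₀, hH w x₀, hHw, hww, hr']
    ring
  refine ⟨r, fun x y => ?_⟩
  have e := hself (x + y)
  simp only [map_add, LinearMap.add_apply, hself, hH y x, hg y x] at e
  linarith

/-- If `Λ²H = d Λ²g` with `d ≠ 0`, then `H` is a multiple of `g`. -/
lemma exists_eq_mul_of_gramDet_eq {H : LinearMap.BilinForm ℝ V} {d : ℝ} (hd : d ≠ 0)
    (hg : ∀ x y, g x y = g y x) (hn : HasPositiveIndex g n) (hn3 : 3 ≤ n)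
    (hH : ∀ x y, H x y = H y x) (h : ∀ x y, gramDet H x y = d * gramDet g x y) :
    ∃ r : ℝ, ∀ x y, H x y = r * g x y := by
  obtain ⟨x₀, hx₀⟩ := hn.exists_pos₀ (by omega)
  refine exists_eq_mul_of_orthogonal hg hH hx₀ fun x w hx hxw => ?_
  obtain ⟨y, hy, hxy, hyw⟩ := hn.exists_pos₂ (by omega) (g x) (g w)
  rw [hg w y] at hyw
  by_contra hne
  have key := wedge_eq_of_gramDet_eq hg hH h
  have e1 := key x y x w
  have e2 := key x y y w
  have e3 := h x y
  rw [hxw, hyw] at e1 e2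
  simp only [gramDet, hxy, hg y x] at e3
  have : H x w * (d * (g x x * g y y)) = 0 := by
    linear_combination H x y * e1 - H x x * e2 - H x w * e3
  have h3 : d * (g x x * g y y) ≠ 0 := mul_ne_zero hd (mul_pos hx hy).ne'
  exact hne ((mul_eq_zero.1 this).resolve_right h3)

variable [FiniteDimensional ℝ V] {R : V →ₗ[ℝ] V →ₗ[ℝ] Module.End ℝ V} {C : ℝ}
  {φ : LinearMap.BilinForm ℝ V} {Φ : Module.End ℝ V}

/-- The trace of the square of a curvature operator is a Gram determinant. -/
lemma trace_curvature_sq (hΦs : ∀ x y, φ x (Φ y) = φ y (Φ x))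
    (hR : ∀ x y z, R x y z = C • (φ y z • Φ x - φ x z • Φ y)) (x y : V) :
    LinearMap.trace ℝ V (R x y * R x y) = -2 * C ^ 2 * gramDet (φ.compl₂ Φ) x y := by
  have h : R x y * R x y =
      (C ^ 2 * φ x (Φ y)) • (φ y).smulRight (Φ x) - (C ^ 2 * φ y (Φ y)) • (φ x).smulRight (Φ x) -
      (C ^ 2 * φ x (Φ x)) • (φ y).smulRight (Φ y) +
      (C ^ 2 * φ x (Φ y)) • (φ x).smulRight (Φ y) := by
    ext z
    simp only [Module.End.mul_apply, hR, map_smul, map_sub, smul_sub, LinearMap.sub_apply,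
      LinearMap.add_apply, LinearMap.smul_apply, LinearMap.smulRight_apply, smul_eq_mul, hΦs y x]
    module
  rw [h]
  simp only [map_add, map_sub, map_smul, LinearMap.trace_smulRight, gramDet,
    LinearMap.compl₂_apply, smul_eq_mul, hΦs y x]
  ring

/-- For a spacelike Jordan Ivanov-Petrova curvature tensor of rank two, defined by the operator
`Φ`, the square `Φ²` is a multiple of the identity. -/
lemma exists_sq_eq_mul (hn : HasPositiveIndex g n) (hn3 : 3 ≤ n)
    (hF : IsSpacelikeRankTwo g (curvatureForm g R))
    (hΦ : ∀ x y, g (Φ x) y = φ x y)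
    (hR : ∀ x y z, R x y z = C • (φ y z • Φ x - φ x z • Φ y))
    (hIP : IsJordanIvanovPetrova g (fun x y => R x y) .spacelike) :
    ∃ r : ℝ, ∀ x y, φ x (Φ y) = r * g x y := by
  have hg := hF.symm
  have hΦs (x y : V) : φ x (Φ y) = φ y (Φ x) := by rw [← hΦ, hg, hΦ]
  have hconj (e f e' f' : V) (he : g e e = 1) (hf : g f f = 1) (hef : g e f = 0)
      (he' : g e' e' = 1) (hf' : g f' f' = 1) (hef' : g e' f' = 0) :
      IsConj (R e f) (R e' f') :=
    hIP _ (span_mem_Gr (orthonormal_pair hg he hf hef)) _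
      (span_mem_Gr (orthonormal_pair hg he' hf' hef')) ![e, f] ![e', f']
      ⟨orthonormal_pair hg he hf hef, rfl⟩ ⟨orthonormal_pair hg he' hf' hef', rfl⟩
  -- orthonormal pairs subject to a linear condition
  have hpair (u : V →ₗ[ℝ] ℝ) : ∃ e f, g e e = 1 ∧ g f f = 1 ∧ g e f = 0 ∧ u e = 0 ∧ u f = 0 := by
    obtain ⟨x, hx, hux⟩ := hn.exists_pos₁ (by omega) u
    obtain ⟨y, hy, hxy, huy⟩ := hn.exists_pos₂ (by omega) (g x) u
    have hunit (x : V) (hx : 0 < g x x) : g ((√(g x x))⁻¹ • x) ((√(g x x))⁻¹ • x) = 1 := by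
      simp only [map_smul, LinearMap.smul_apply, smul_eq_mul]
      have h1 : √(g x x) ≠ 0 := (Real.sqrt_pos.2 hx).ne'
      have h2 : √(g x x) * √(g x x) = g x x := Real.mul_self_sqrt hx.le
      field_simp
      linarith
    exact ⟨_, _, hunit x hx, hunit y hy, by simp [hxy], by simp [hux], by simp [huy]⟩
  set H : LinearMap.BilinForm ℝ V := φ.compl₂ Φ with hHdef
  have hHapp (x y : V) : H x y = φ x (Φ y) := rfl
  have hH (x y : V) : H x y = H y x := hΦs x y
  obtain ⟨e₀, f₀, he₀, hf₀, hef₀, -, -⟩ := hpair 0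
  have hne (e f : V) (he : g e e = 1) (hf : g f f = 1) (hef : g e f = 0) : R e f ≠ 0 := by
    intro h0
    refine hF.ne_zero e f (by rw [he]; exact one_pos) (by rw [hf]; exact one_pos) hef ?_
    ext z w
    simp [h0]
  have hC : C ≠ 0 := by
    rintro rfl
    refine hne e₀ f₀ he₀ hf₀ hef₀ ?_
    ext z
    simp [hR]
  set d := gramDet H e₀ f₀ with hd
  have hdet (e f : V) (he : g e e = 1) (hf : g f f = 1) (hef : g e f = 0) : gramDet H e f = d := by
    obtain ⟨c, hc⟩ := hconj e f e₀ f₀ he hf hef he₀ hf₀ hef₀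
    have h1 : R e₀ f₀ = c * R e f * (c⁻¹ : (Module.End ℝ V)ˣ) := by
      rw [hc.eq, mul_assoc, Units.mul_inv, mul_one]
    have h2 : R e₀ f₀ * R e₀ f₀ = c * (R e f * R e f) * (c⁻¹ : (Module.End ℝ V)ˣ) := by
      rw [h1]
      simp only [mul_assoc, Units.inv_mul_cancel_left]
    have h3 := congrArg (LinearMap.trace ℝ V) h2
    rw [LinearMap.trace_conj, trace_curvature_sq hΦs hR, trace_curvature_sq hΦs hR] at h3
    have h4 : (-2 * C ^ 2) ≠ 0 := by simpa using hC
    exact (mul_left_cancel₀ h4 h3).symm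
  have hall (x y : V) : gramDet H x y = d * gramDet g x y := by
    have := eq_zero_of_spacelike_pairs hn (by omega)
      (fun x y => gramDet H x y - d * gramDet g x y)
      (fun x y y' => H x x * (H y y' + H y' y) - H x y * H y' x - H x y' * H y x -
        d * (g x x * (g y y' + g y' y) - g x y * g y' x - g x y' * g y x))
      (fun x x' y => H y y * (H x x' + H x' x) - H x y * H y x' - H x' y * H y x -
        d * (g y y * (g x x' + g x' x) - g x y * g y x' - g x' y * g y x))
      (fun x y y' t => by
        simp only [gramDet, map_add, map_smul, LinearMap.add_apply, LinearMap.smul_apply,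
          smul_eq_mul]
        ring)
      (fun x x' y t => by
        simp only [gramDet, map_add, map_smul, LinearMap.add_apply, LinearMap.smul_apply,
          smul_eq_mul]
        ring)
      (fun x y hx hxy => by
        obtain ⟨e, f, α, β, γ, he, hf, hef, -, -, rfl, rfl⟩ := exists_gramSchmidt hg hx hxy
        have hgd : gramDet g e f = 1 := by simp [gramDet, he, hf, hef]
        simp only [gramDet_smul_add, hdet e f he hf hef, hgd]
        ring) x y
    linarith
  by_cases hd0 : d = 0
  · -- the nilpotent case: `H = 0`
    refine ⟨0, fun x y => ?_⟩
    have hH0 : ∀ v, H v v = 0 := by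
      by_contra! hcon
      obtain ⟨v, hv⟩ := hcon
      have hw := wedge_eq_of_gramDet_eq hg hH hall
      obtain ⟨e, f, he, hf, hef, hve, hvf⟩ := hpair (H v)
      have hz {a b : V} (ha : H v a = 0) : H a b = 0 := by
        have := hw v a v b
        rw [hd0, hH a v, ha] at this
        simpa [hv] using this
      have hsq : R e f * R e f = 0 := by
        ext z
        simp only [Module.End.mul_apply, hR, map_smul, map_sub, ← hHapp, hz hve, hz hvf]
        simp
      apply hv
      refine apply_self_eq_zero_of_spacelike H (by rw [he₀]; exact one_pos) (fun y hy => ?_) v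
      -- on every spacelike plane, the square of the curvature operator vanishes
      obtain ⟨x, hx, hyx⟩ := hn.exists_pos₁ (by omega) (g y)
      have hdet : 0 < gramDet g y x := by simpa [gramDet, hyx] using mul_pos hy hx
      obtain ⟨f', e', α, -, -, hf', he', hef', hα, -, hyf, -⟩ := exists_gramSchmidt hg hy hdet
      have hsq' : R e' f' * R e' f' = 0 := by
        have h1 := (hconj e f e' f' he hf hef he' hf' (by rw [hg, hef'])).pow 2
        rw [pow_two, pow_two, hsq] at h1
        obtain ⟨c, hc⟩ := h1
        have := hc.eq
        rw [mul_zero] at this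
        exact (Units.mul_left_eq_zero c).1 this.symm
      obtain ⟨z, hz0, hz1⟩ : ∃ z, φ f' z = 0 ∧ φ e' z ≠ 0 := by
        by_contra! hcon
        refine hF.ne_zero e' f' (by rw [he']; exact one_pos) (by rw [hf']; exact one_pos)
          (by rw [hg, hef']) ?_
        by_cases hf0 : φ f' = 0
        · ext z w
          simp [hR, hΦ, hf0]
        · obtain ⟨v, hv⟩ := exists_apply_eq_one hf0
          have hpr := LinearMap.apply_eq_mul_of_ker hv hcon
          ext z w
          simp only [curvatureForm_apply, hR, map_smul, map_sub, LinearMap.smul_apply,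
            LinearMap.sub_apply, hΦ, hpr z, hpr w, LinearMap.zero_apply, smul_eq_mul]
          ring
      have h1 := hF.skew' e' f' (R e' f' z) z
      have h2 : R e' f' (R e' f' z) = 0 := LinearMap.congr_fun hsq' z
      have h3 : R e' f' z = -(C * φ e' z) • Φ f' := by
        rw [hR, hz0]
        module
      rw [curvatureForm_apply, h2, map_zero, LinearMap.zero_apply, curvatureForm_apply, h3] at h1
      simp only [map_smul, LinearMap.smul_apply, hΦ, ← hHapp, smul_eq_mul] at h1
      have h4 : H f' f' = 0 := by simpa [hC, hz1] using h1
      rw [hyf]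
      simp [h4]
    have e := hH0 (x + y)
    simp only [map_add, LinearMap.add_apply, hH0, hH y x] at e
    rw [zero_mul, ← hHapp]
    linarith
  · exact exists_eq_mul_of_gramDet_eq hd0 hg hn hn3 hH hall

end Square

/-! ### Conjugacy of the higher order curvature operators -/

section Conjugacy

variable {V : Type*} [AddCommGroup V] [Module ℝ V]

/-- Projections of the same rank are conjugate. -/
lemma isConj_of_isIdempotentElem [FiniteDimensional ℝ V] {A B : Module.End ℝ V}
    (hA : IsIdempotentElem A) (hB : IsIdempotentElem B) (h : LinearMap.trace ℝ V A = LinearMap.trace ℝ V B) :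
    IsConj A B := by
  have hAp := LinearMap.IsIdempotentElem.isProj_range A hA
  have hBp := LinearMap.IsIdempotentElem.isProj_range B hB
  have hr : Module.finrank ℝ (LinearMap.range A) = Module.finrank ℝ (LinearMap.range B) := by
    have h1 := hAp.trace
    have h2 := hBp.trace
    rw [h, h2] at h1
    exact_mod_cast h1.symm
  have hk : Module.finrank ℝ (LinearMap.ker A) = Module.finrank ℝ (LinearMap.ker B) := by
    have h1 := LinearMap.finrank_range_add_finrank_ker A
    have h2 := LinearMap.finrank_range_add_finrank_ker B
    omega
  have hAc : IsCompl (LinearMap.range A) (LinearMap.ker A) := LinearMap.IsIdempotentElem.isCompl hA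
  have hBc : IsCompl (LinearMap.range B) (LinearMap.ker B) := LinearMap.IsIdempotentElem.isCompl hB
  let T : V ≃ₗ[ℝ] V := (Submodule.prodEquivOfIsCompl _ _ hAc).symm ≪≫ₗ
    (LinearEquiv.ofFinrankEq _ _ hr).prodCongr (LinearEquiv.ofFinrankEq _ _ hk) ≪≫ₗ
    Submodule.prodEquivOfIsCompl _ _ hBc
  have hT (a : LinearMap.range A) (b : LinearMap.ker A) : T (a + b) =
      (LinearEquiv.ofFinrankEq _ _ hr a : V) + (LinearEquiv.ofFinrankEq _ _ hk b : V) := by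
    have : (a + b : V) = Submodule.prodEquivOfIsCompl _ _ hAc (a, b) := by simp
    simp only [T, LinearEquiv.trans_apply, this, LinearEquiv.symm_apply_apply]
    simp
  refine ⟨LinearMap.GeneralLinearGroup.ofLinearEquiv T, ?_⟩
  ext v
  obtain ⟨⟨a, b⟩, rfl⟩ := (Submodule.prodEquivOfIsCompl _ _ hAc).surjective v
  have h1 : A (a + b) = a := by
    rw [map_add, hAp.map_id a a.2, LinearMap.mem_ker.1 b.2, add_zero]
  have h2 : T a = LinearEquiv.ofFinrankEq _ _ hr a := by simpa using hT a 0
  have h3 (a : LinearMap.range B) (b : LinearMap.ker B) : B (a + b) = a := by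
    rw [map_add, hBp.map_id a a.2, LinearMap.mem_ker.1 b.2, add_zero]
  change T (A (a + b)) = B (T (a + b))
  rw [h1, hT, h2, h3]

lemma isConj_smul {A B : Module.End ℝ V} (h : IsConj A B) (c : ℝ) : IsConj (c • A) (c • B) := by
  obtain ⟨T, hT⟩ := h
  exact ⟨T, by rw [SemiconjBy, mul_smul_comm, hT.eq, smul_mul_assoc]⟩

variable {g : LinearMap.BilinForm ℝ V} {n : ℕ} {R : V →ₗ[ℝ] V →ₗ[ℝ] Module.End ℝ V} {C r : ℝ}
  {φ : LinearMap.BilinForm ℝ V} {Φ : Module.End ℝ V}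

/-- The higher order curvature operator of a plane `π` is a multiple of the sum
`∑ φ(eᵢ, ·) Φ eᵢ`, which is a multiple of the orthogonal projection to `Φ π` if `r ≠ 0`. -/
lemma higherCurvature_eq (hΦ : ∀ x y, φ x (Φ y) = r * g x y)
    (hR : ∀ x y z, R x y z = C • (φ y z • Φ x - φ x z • Φ y)) {ε : Causal} {k : ℕ} {e : Fin k → V}
    (he : ∀ i j, g (e i) (e j) = if i = j then ε.sign else 0) :
    higherCurvature (fun x y => R x y) e =
      (-2 * (k - 1) * C ^ 2 * r * ε.sign) • ∑ i, (φ (e i)).smulRight (Φ (e i)) := by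
  set a : Fin k → Module.End ℝ V := fun i => (φ (e i)).smulRight (Φ (e i)) with ha
  have hterm (i j : Fin k) : R (e i) (e j) * R (e i) (e j) =
      (-C ^ 2 * r * ε.sign) • (a i + a j) +
        if i = j then (2 * C ^ 2 * r * ε.sign) • a i else 0 := by
    ext z
    simp only [Module.End.mul_apply, hR, map_smul, map_sub, hΦ, he]
    by_cases hij : i = j
    · subst hij
      simp [ha]
      module
    · simp only [hij, Ne.symm hij, if_false, if_true, ha, LinearMap.add_apply,
        LinearMap.smul_apply, LinearMap.smulRight_apply, smul_eq_mul, LinearMap.zero_apply]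
      module
  simp only [higherCurvature, hterm, Finset.sum_add_distrib, ← Finset.smul_sum, Finset.sum_const,
    Finset.card_univ, Fintype.card_fin, Finset.sum_ite_eq, Finset.mem_univ, if_true]
  module

/-- The pointwise form of the theorem: an algebraic curvature tensor of spacelike rank two whose
skew-symmetric curvature operators have constant Jordan normal form on spacelike planes is Jordan
Stanilov for planes of both causal types. -/
theorem isJordanStanilov_of_isJordanIvanovPetrova [FiniteDimensional ℝ V]
    (hnd : g.Nondegenerate)
    (hg : ∀ x y, g x y = g y x) (hn : HasPositiveIndex g n)
    (hn' : 5 ≤ n ∨ 4 ≤ n ∧ ∀ v, v ≠ 0 → 0 < g v v)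
    (hF : IsCurvatureTensor (curvatureForm g R))
    (hrank : HasConstantRank g (fun x y => R x y) .spacelike 2)
    (hIP : IsJordanIvanovPetrova g (fun x y => R x y) .spacelike) (ε : Causal) (k : ℕ) :
    IsJordanStanilov g (fun x y => R x y) ε k := by
  have hF' := isSpacelikeRankTwo_of_hasConstantRank hg hnd hn (by omega) hF hrank
  obtain ⟨C, φ, -, hFφ⟩ := hF'.exists_form hn hn'
  let Φ : Module.End ℝ V := (g.toDual hnd).symm ∘ₗ φ
  have hΦ (x y : V) : g (Φ x) y = φ x y :=
    LinearMap.BilinForm.apply_toDual_symm_apply (hB := hnd) _ _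
  have hR (x y z : V) : R x y z = C • (φ y z • Φ x - φ x z • Φ y) := by
    rw [← sub_eq_zero]
    refine hnd.1 _ fun w => ?_
    have := hFφ x y z w
    rw [curvatureForm_apply] at this
    simp only [map_sub, map_smul, LinearMap.sub_apply, LinearMap.smul_apply, smul_eq_mul, hΦ, this]
    ring
  obtain ⟨r, hr⟩ := exists_sq_eq_mul hn (by omega) hF' hΦ hR hIP
  intro π _ σ _ e f he hf
  rw [higherCurvature_eq hr hR he.1, higherCurvature_eq hr hR hf.1]
  by_cases hr0 : r = 0
  · rw [hr0, mul_zero, zero_mul, zero_smul, zero_smul]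
  have hrε : r * ε.sign ≠ 0 := mul_ne_zero hr0 ε.sign_ne_zero
  have hproj {e : Fin k → V} (he : ∀ i j, g (e i) (e j) = if i = j then ε.sign else 0) :
      IsIdempotentElem ((r * ε.sign)⁻¹ • ∑ i, (φ (e i)).smulRight (Φ (e i))) := by
    have hfix (j : Fin k) : ((r * ε.sign)⁻¹ • ∑ i, (φ (e i)).smulRight (Φ (e i))) (Φ (e j)) =
        Φ (e j) := by
      simp only [LinearMap.smul_apply, LinearMap.sum_apply, LinearMap.smulRight_apply, hr, he,
        mul_ite, mul_zero, ite_smul, zero_smul, Finset.sum_ite_eq', Finset.mem_univ, if_true,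
        smul_smul, inv_mul_cancel₀ hrε, one_smul]
    ext z
    rw [Module.End.mul_apply]
    nth_rw 2 [LinearMap.smul_apply]
    rw [LinearMap.sum_apply, map_smul, map_sum, LinearMap.smul_apply, LinearMap.sum_apply]
    simp only [LinearMap.smulRight_apply, map_smul, hfix]
  have htrace {e : Fin k → V} (he : ∀ i j, g (e i) (e j) = if i = j then ε.sign else 0) :
      LinearMap.trace ℝ V ((r * ε.sign)⁻¹ • ∑ i, (φ (e i)).smulRight (Φ (e i))) = k := by
    simp only [map_smul, map_sum, LinearMap.trace_smulRight, hr, he, if_true, Finset.sum_const,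
      Finset.card_univ, Fintype.card_fin, nsmul_eq_mul, smul_eq_mul]
    rw [mul_left_comm, inv_mul_cancel₀ hrε, mul_one]
  have hconj := isConj_of_isIdempotentElem (hproj he.1) (hproj hf.1)
    ((htrace he.1).trans (htrace hf.1).symm)
  have := isConj_smul hconj (-2 * (k - 1) * C ^ 2 * r * ε.sign * (r * ε.sign))
  simpa only [smul_smul, mul_assoc, mul_inv_cancel₀ hrε, mul_one] using this

end Conjugacy

/-! ### The signature of a symmetric bilinear form -/

section Signature

variable {V : Type*} [AddCommGroup V] [Module ℝ V] [FiniteDimensional ℝ V]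
  {g : LinearMap.BilinForm ℝ V} {p q : ℕ}

lemma HasSignature.hasPositiveIndex (h : HasSignature g p q) : HasPositiveIndex g q := by
  obtain ⟨S, hS, hpos⟩ := exists_finrank_eq_sigPos_and_posDef g.toQuadraticMap
  refine ⟨S, inferInstance, hS.trans h.2.2, fun x hx hx0 => ?_⟩
  simpa using hpos ⟨x, hx⟩ (by simpa using hx0)

/-- A form without negative directions is positive definite. -/
lemma HasSignature.posDef (h : HasSignature g 0 q) (hg : ∀ x y, g x y = g y x) (v : V)
    (hv : v ≠ 0) : 0 < g v v := by
  have hnonneg (v : V) : 0 ≤ g v v := by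
    by_contra! hneg
    have hv : v ≠ 0 := by rintro rfl; simp at hneg
    have := le_sigNeg_of_negDef g.toQuadraticMap (V := Submodule.span ℝ {v}) (by
      rintro ⟨x, hx⟩ hx0
      obtain ⟨c, rfl⟩ := Submodule.mem_span_singleton.1 hx
      have hc : c ≠ 0 := by rintro rfl; simp at hx0
      have : 0 < -(c * (c * g v v)) := by
        have hc2 : 0 < c * c := mul_self_pos.2 hc
        nlinarith
      simpa using this)
    rw [h.2.1, finrank_span_singleton hv] at this
    omega
  refine lt_of_le_of_ne (hnonneg v) fun h0 => hv (h.1.1 v fun w => ?_)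
  by_contra hne
  -- the form is negative at `w + t v`
  set t := -(g w w + 1) / (2 * g v w) with ht
  have htv : t * g v w = -(g w w + 1) / 2 := by
    rw [ht]
    field_simp
  have := hnonneg (w + t • v)
  simp only [map_add, map_smul, LinearMap.add_apply, LinearMap.smul_apply, smul_eq_mul, ← h0,
    hg w v, htv] at this
  linarith

end Signature

/-! ### The symmetries of the curvature of a metric on an open set -/

section LocalCurvature

open Filter Topology

variable {E : Type*} [NormedAddCommGroup E] [NormedSpace ℝ E]

lemma two_le_infty : (2 : WithTop ℕ∞) ≤ ∞ :=
  WithTop.coe_le_coe.2 (le_top : (2 : ℕ∞) ≤ ⊤)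

lemma hasFDerivAt_apply_apply {F : Type*} [NormedAddCommGroup F] [NormedSpace ℝ F]
    {S : E → E →L[ℝ] E →L[ℝ] F} {y : E} (hS : DifferentiableAt ℝ S y) (v w : E) :
    HasFDerivAt (fun z => S z v w) (((ContinuousLinearMap.apply ℝ F w) ∘L
      (ContinuousLinearMap.apply ℝ (E →L[ℝ] F) v)) ∘L fderiv ℝ S y) y :=
  ((ContinuousLinearMap.apply ℝ F w) ∘L
    (ContinuousLinearMap.apply ℝ (E →L[ℝ] F) v)).hasFDerivAt.comp y hS.hasFDerivAt

/-- The derivative of a family of symmetric bilinear maps is symmetric. -/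
lemma fderiv_comm_of_eventually {F : Type*} [NormedAddCommGroup F] [NormedSpace ℝ F]
    {S : E → E →L[ℝ] E →L[ℝ] F} {y : E} (hS : DifferentiableAt ℝ S y)
    (h : ∀ᶠ z in 𝓝 y, ∀ v w, S z v w = S z w v) (u v w : E) :
    fderiv ℝ S y u v w = fderiv ℝ S y u w v := by
  have h1 := (hasFDerivAt_apply_apply hS v w).unique
    ((hasFDerivAt_apply_apply hS w v).congr_of_eventuallyEq (h.mono fun z hz => hz v w))
  exact congrArg (fun L : E →L[ℝ] F => L u) h1

lemma christoffelFirst_comm {G : E → E →L[ℝ] E →L[ℝ] ℝ} {y : E} (hG : DifferentiableAt ℝ G y)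
    (hsymm : ∀ᶠ z in 𝓝 y, ∀ v w, G z v w = G z w v) (u v w : E) :
    christoffelFirst G y u v w = christoffelFirst G y v u w := by
  rw [christoffelFirst_apply, christoffelFirst_apply, fderiv_comm_of_eventually hG hsymm w u v]
  ring

/-- A metric on a neighbourhood of `y`: smooth, symmetric, and non-degenerate. -/
structure IsMetricNear (G : E → E →L[ℝ] E →L[ℝ] ℝ) (y : E) : Prop where
  contDiffAt : ContDiffAt ℝ ∞ G y
  symm : ∀ᶠ z in 𝓝 y, ∀ v w, G z v w = G z w v
  isInvertible : (G y).IsInvertible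

namespace IsMetricNear

variable {G : E → E →L[ℝ] E →L[ℝ] ℝ} {y : E}

lemma eventually_isInvertible [CompleteSpace E] (h : IsMetricNear G y) :
    ∀ᶠ z in 𝓝 y, (G z).IsInvertible := by
  obtain ⟨e, he⟩ := h.isInvertible
  have := h.contDiffAt.continuousAt.eventually (he ▸ e.nhds)
  filter_upwards [this] with z ⟨e', he'⟩
  exact ⟨e', he'⟩

lemma eventually_differentiableAt (h : IsMetricNear G y) :
    ∀ᶠ z in 𝓝 y, DifferentiableAt ℝ G z := by
  have h1 : ContDiffAt ℝ 1 G y := h.contDiffAt.of_le (by simp)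
  filter_upwards [h1.eventually (by simp)] with z hz
  exact hz.differentiableAt (by simp)

lemma differentiableAt_fderiv (h : IsMetricNear G y) : DifferentiableAt ℝ (fderiv ℝ G) y :=
  (h.contDiffAt.fderiv_right (m := 1) (by rw [one_add_one_eq_two]; exact two_le_infty)).differentiableAt
    (by simp)

lemma differentiableAt_christoffelFirst (h : IsMetricNear G y) :
    DifferentiableAt ℝ (christoffelFirst G) y := by
  have := h.differentiableAt_fderiv
  have hflip : DifferentiableAt ℝ (fun z => (fderiv ℝ G z).flip) y :=
    (ContinuousLinearMap.flipₗᵢ ℝ E E (E →L[ℝ] ℝ)).toContinuousLinearEquiv.differentiableAt.comp y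
      this
  exact ((this.add hflip).sub ((differentiableAt_const _).clm_comp hflip)).const_smul
    (1 / 2 : ℝ)

lemma differentiableAt_christoffel [CompleteSpace E] (h : IsMetricNear G y) :
    DifferentiableAt ℝ (christoffel G) y := by
  have h1 := h.differentiableAt_christoffelFirst
  have h2 : DifferentiableAt ℝ (fun z => (G z).inverse) y :=
    ((h.isInvertible.contDiffAt_map_inverse (n := 1)).differentiableAt (by simp)).comp y
      h.eventually_differentiableAt.self_of_nhds
  exact ((ContinuousLinearMap.compL ℝ E (E →L[ℝ] ℝ) E).differentiableAt.comp y h2).clm_comp h1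

/-- The Koszul formula. -/
lemma eventually_apply_christoffel [CompleteSpace E] (h : IsMetricNear G y) :
    ∀ᶠ z in 𝓝 y, ∀ u v w, G z (christoffel G z u v) w = christoffelFirst G z u v w := by
  filter_upwards [h.eventually_isInvertible] with z ⟨e, he⟩ u v w
  rw [christoffel_apply, ← he, ContinuousLinearMap.inverse_equiv]
  simp

/-- The Levi-Civita connection is torsion-free. -/
lemma eventually_christoffel_comm (h : IsMetricNear G y) :
    ∀ᶠ z in 𝓝 y, ∀ u v, christoffel G z u v = christoffel G z v u := by
  filter_upwards [h.eventually_differentiableAt, h.symm.eventually_nhds] with z hz hs u v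
  rw [christoffel_apply, christoffel_apply]
  congr 1
  ext w
  exact christoffelFirst_comm hz hs u v w

lemma fderiv_christoffel_comm [CompleteSpace E] (h : IsMetricNear G y) (u v w : E) :
    fderiv ℝ (christoffel G) y u v w = fderiv ℝ (christoffel G) y u w v :=
  fderiv_comm_of_eventually h.differentiableAt_christoffel h.eventually_christoffel_comm u v w

lemma localCurvature_swap (u v w : E) : localCurvature G y u v w = -localCurvature G y v u w := by
  simp [localCurvature]
  abel

/-- The first Bianchi identity. -/
lemma localCurvature_bianchi [CompleteSpace E] (h : IsMetricNear G y) (u v w : E) :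
    localCurvature G y u v w + localCurvature G y v w u + localCurvature G y w u v = 0 := by
  have hc := h.eventually_christoffel_comm.self_of_nhds
  simp only [localCurvature, add_apply, sub_apply,
    ContinuousLinearMap.comp_apply, h.fderiv_christoffel_comm v w u,
    h.fderiv_christoffel_comm w v u, h.fderiv_christoffel_comm u w v, hc w u, hc w v, hc v u]
  abel

/-- The curvature operators are skew-symmetric. -/
lemma localCurvature_skew [CompleteSpace E] (h : IsMetricNear G y) (u v w z : E) :
    G y (localCurvature G y u v w) z = -G y (localCurvature G y u v z) w := by
  have hG := h.eventually_differentiableAt.self_of_nhds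
  have hΓ := h.differentiableAt_christoffel
  have hDG := h.differentiableAt_fderiv
  have hs := h.symm.self_of_nhds
  have hK := h.eventually_apply_christoffel.self_of_nhds
  have hGs := fderiv_comm_of_eventually hG h.symm
  -- the derivative of the Christoffel symbols of the first kind
  have hΓ₁ (u v w t : E) : G y (fderiv ℝ (christoffel G) y u v w) t =
      1 / 2 * (fderiv ℝ (fderiv ℝ G) y u v w t + fderiv ℝ (fderiv ℝ G) y u w v t -
        fderiv ℝ (fderiv ℝ G) y u t v w) - fderiv ℝ G y u (christoffel G y v w) t := by
    have h1 := (hG.hasFDerivAt.clm_apply (hasFDerivAt_apply_apply hΓ v w)).clm_apply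
      (hasFDerivAt_const t y)
    have hD (a b c : E) : HasFDerivAt (fun z => fderiv ℝ G z a b c)
        ((ContinuousLinearMap.apply ℝ ℝ c) ∘L ((ContinuousLinearMap.apply ℝ (E →L[ℝ] ℝ) b) ∘L
          (ContinuousLinearMap.apply ℝ (E →L[ℝ] E →L[ℝ] ℝ) a)) ∘L fderiv ℝ (fderiv ℝ G) y) y :=
      (ContinuousLinearMap.apply ℝ ℝ c).hasFDerivAt.comp y (hasFDerivAt_apply_apply hDG a b)
    have h2 := (((hD v w t).add (hD w v t)).sub (hD t v w)).const_mul (1 / 2 : ℝ)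
    have h3 := h1.unique (h2.congr_of_eventuallyEq (by
      filter_upwards [h.eventually_apply_christoffel] with z hz
      rw [hz, christoffelFirst_apply]
      rfl))
    have h4 := congrArg (fun L : E →L[ℝ] ℝ => L u) h3
    simp at h4
    linarith
  -- the metric is parallel
  have hpar (u a t : E) : fderiv ℝ G y u a t =
      christoffelFirst G y u a t + christoffelFirst G y u t a := by
    rw [christoffelFirst_apply, christoffelFirst_apply, hGs u t a]
    ring
  have hsnd (u v : E) : fderiv ℝ (fderiv ℝ G) y u v = fderiv ℝ (fderiv ℝ G) y v u :=
    h.contDiffAt.isSymmSndFDerivAt (by simpa using two_le_infty) u v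
  have hsnd' (u v w t : E) :
      fderiv ℝ (fderiv ℝ G) y u v w t = fderiv ℝ (fderiv ℝ G) y u v t w := by
    have h1 : ∀ᶠ z in 𝓝 y, ∀ a b, fderiv ℝ G z v a b = fderiv ℝ G z v b a := by
      filter_upwards [h.eventually_differentiableAt, h.symm.eventually_nhds] with z hz hs
      exact fderiv_comm_of_eventually hz hs v
    have h2 : HasFDerivAt (fun z => fderiv ℝ G z v)
        (ContinuousLinearMap.apply ℝ (E →L[ℝ] E →L[ℝ] ℝ) v ∘L fderiv ℝ (fderiv ℝ G) y) y :=
      (ContinuousLinearMap.apply ℝ (E →L[ℝ] E →L[ℝ] ℝ) v).hasFDerivAt.comp y hDG.hasFDerivAt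
    have h3 := fderiv_comm_of_eventually h2.differentiableAt h1 u w t
    rw [h2.fderiv] at h3
    simpa using h3
  have key (u v w t : E) : G y (localCurvature G y u v w) t =
      1 / 2 * (fderiv ℝ (fderiv ℝ G) y u w v t - fderiv ℝ (fderiv ℝ G) y u t v w) -
      1 / 2 * (fderiv ℝ (fderiv ℝ G) y v w u t - fderiv ℝ (fderiv ℝ G) y v t u w) -
      G y (christoffel G y u t) (christoffel G y v w) +
      G y (christoffel G y v t) (christoffel G y u w) := by
    simp only [localCurvature, add_apply, sub_apply, map_add, map_sub,
      ContinuousLinearMap.comp_apply, hΓ₁, hK, hpar, hsnd v u]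
    ring
  rw [key, key, hs (christoffel G y u w), hs (christoffel G y v w), hsnd' u w, hsnd' u z,
    hsnd' v w, hsnd' v z]
  ring

end IsMetricNear
end LocalCurvature

/-! ### The curvature of a pseudo-Riemannian manifold -/

section Curvature

open Filter Topology

variable {E : Type*} [NormedAddCommGroup E] [NormedSpace ℝ E]
  {M : Type*} [TopologicalSpace M] [ChartedSpace E M] [IsManifold 𝓘(ℝ, E) ∞ M] {p q : ℕ}

namespace PseudoRiemannianMetric

/-- The differential of the preferred chart at its base point is the identity of the model space:
tangent spaces are identified with the model space by means of the preferred charts. -/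
lemma chartDeriv_eq_id (P : M) : chartDeriv P = ContinuousLinearMap.id ℝ E := by
  have : IsManifold 𝓘(ℝ, E) 1 M := IsManifold.of_le (n := ∞) (by simp)
  exact mfderiv_extChartAt_self (I := 𝓘(ℝ, E)) (x := P)

lemma chartInvDeriv_eq_id (P : M) :
    chartInvDeriv P (chartAt E P P) = ContinuousLinearMap.id ℝ E := by
  have : IsManifold 𝓘(ℝ, E) 1 M := IsManifold.of_le (n := ∞) (by simp)
  have := mfderivWithin_range_extChartAt_symm (I := 𝓘(ℝ, E)) (x := P)
  simp only [modelWithCornersSelf_coe, Set.range_id, mfderivWithin_univ] at this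
  exact this

variable (g : PseudoRiemannianMetric E M p q) (P : M)

/-- The inner product on the tangent space at `P`, as a form on the model space. -/
noncomputable def modelVal : E →L[ℝ] E →L[ℝ] ℝ := g.val P

lemma modelVal_symm (u v : E) : g.modelVal P u v = g.modelVal P v u := g.symm P u v

lemma inChart_apply (y u v : E) : g.inChart P y u v =
    g.modelVal ((chartAt E P).symm y) (chartInvDeriv P y u) (chartInvDeriv P y v) := rfl

lemma inChart_self : g.inChart P (chartAt E P P) = g.modelVal P := by
  have h : (chartAt E P).symm (chartAt E P P) = P := (chartAt E P).left_inv (mem_chart_source E P)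
  ext u v
  rw [inChart_apply, h]
  have h1 : ∀ D : E →L[ℝ] E, D = ContinuousLinearMap.id ℝ E →
      g.modelVal P (D u) (D v) = g.modelVal P u v := by rintro _ rfl; rfl
  exact h1 _ (chartInvDeriv_eq_id P)

lemma inChart_symm (y u v : E) : g.inChart P y u v = g.inChart P y v u := by
  rw [inChart_apply, inChart_apply]
  exact g.modelVal_symm _ _ _

open Bundle in
/-- The metric in a chart is smooth: the differential of the inverse of the chart maps constant
vector fields to smooth vector fields along it. -/
lemma contDiffOn_inChart [FiniteDimensional ℝ E] :
    ContDiffOn ℝ ∞ (g.inChart P) (chartAt E P).target := by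
  rw [contDiffOn_clm_apply]
  intro u
  rw [contDiffOn_clm_apply]
  intro v y hy
  have hopen := (chartAt E P).open_target.mem_nhds hy
  have hb : ContMDiffAt 𝓘(ℝ, E) 𝓘(ℝ, E) ∞ (chartAt E P).symm y :=
    (contMDiffOn_chart_symm (n := ∞)).contMDiffAt hopen
  have hD (w : E) : ContMDiffAt 𝓘(ℝ, E) 𝓘(ℝ, E).tangent ∞
      (fun z => TotalSpace.mk' E (E := TangentSpace 𝓘(ℝ, E)) ((chartAt E P).symm z)
        (chartInvDeriv P z w)) y := by
    have h1 : ContMDiffOn 𝓘(ℝ, E).tangent 𝓘(ℝ, E).tangent ∞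
        (tangentMapWithin 𝓘(ℝ, E) 𝓘(ℝ, E) (chartAt E P).symm (chartAt E P).target)
        (TotalSpace.proj ⁻¹' (chartAt E P).target) :=
      (contMDiffOn_chart_symm (n := ∞)).contMDiffOn_tangentMapWithin (by simp)
        (chartAt E P).open_target.uniqueMDiffOn
    have h2 : ContMDiffAt 𝓘(ℝ, E) 𝓘(ℝ, E).tangent ∞
        (fun z => (⟨z, w⟩ : TangentBundle 𝓘(ℝ, E) E)) y :=
      contMDiffAt_vectorSpace_iff_contDiffAt.2 contDiffAt_const
    have h3 : ContMDiffAt 𝓘(ℝ, E) 𝓘(ℝ, E).tangent ∞ (fun z => tangentMapWithin 𝓘(ℝ, E) 𝓘(ℝ, E)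
        (chartAt E P).symm (chartAt E P).target (⟨z, w⟩ : TangentBundle 𝓘(ℝ, E) E)) y :=
      (h1.contMDiffAt (x := (⟨y, w⟩ : TangentBundle 𝓘(ℝ, E) E))
        (((chartAt E P).open_target.preimage
          (FiberBundle.continuous_proj E (TangentSpace 𝓘(ℝ, E)))).mem_nhds hy)).comp y h2
    refine h3.congr_of_eventuallyEq ?_
    filter_upwards [hopen] with z hz
    have h4 : mfderivWithin 𝓘(ℝ, E) 𝓘(ℝ, E) (chartAt E P).symm (chartAt E P).target z =
        mfderiv 𝓘(ℝ, E) 𝓘(ℝ, E) (chartAt E P).symm z :=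
      mfderivWithin_of_mem_nhds ((chartAt E P).open_target.mem_nhds hz)
    simp only [tangentMapWithin, h4]
    rfl
  have hg : ContMDiffAt 𝓘(ℝ, E) 𝓘(ℝ) ∞ (fun z => g.inChart P z u v) y := by
    have : ContMDiffAt 𝓘(ℝ, E) (𝓘(ℝ, E).prod 𝓘(ℝ)) ∞ (fun z => TotalSpace.mk' ℝ
        (E := Bundle.Trivial M ℝ) ((chartAt E P).symm z)
        (g.val ((chartAt E P).symm z) (chartInvDeriv P z u) (chartInvDeriv P z v))) y := by
      apply ContMDiffAt.clm_bundle_apply₂ (F₁ := E) (F₂ := E)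
      · exact g.contMDiff.contMDiffAt.comp y hb
      · exact hD u
      · exact hD v
    simp only [contMDiffAt_totalSpace] at this
    exact this.2
  exact hg.contDiffAt.contDiffWithinAt

lemma isMetricNear_inChart [FiniteDimensional ℝ E] :
    IsMetricNear (g.inChart P) (chartAt E P P) where
  contDiffAt := (g.contDiffOn_inChart P).contDiffAt
    ((chartAt E P).open_target.mem_nhds (mem_chart_target E P))
  symm := .of_forall fun y => g.inChart_symm P y
  isInvertible := by
    rw [inChart_self]
    have hinj : Function.Injective (g.modelVal P : E →ₗ[ℝ] (E →L[ℝ] ℝ)) := by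
      rw [← LinearMap.ker_eq_bot, LinearMap.ker_eq_bot']
      intro x hx
      exact (g.signature P).1.1 x fun y => congrArg (fun L : E →L[ℝ] ℝ => L y) hx
    have hdim : Module.finrank ℝ E = Module.finrank ℝ (E →L[ℝ] ℝ) := by
      rw [← LinearMap.toContinuousLinearMap.finrank_eq]
      exact Subspace.dual_finrank_eq.symm
    refine ⟨(LinearEquiv.ofInjectiveOfFinrankEq _ hinj hdim).toContinuousLinearEquiv, ?_⟩
    rfl

/-- The form `g_P` on the model space. -/
noncomputable def modelForm : LinearMap.BilinForm ℝ E := g.form P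

lemma modelForm_apply (x y : E) : g.modelForm P x y = g.inChart P (chartAt E P P) x y := by
  rw [inChart_self]; rfl

/-- The curvature operators at `P` as a bilinear map on the model space. -/
noncomputable def modelCurvature : E →ₗ[ℝ] E →ₗ[ℝ] Module.End ℝ E :=
  LinearMap.mk₂ ℝ (fun x y => (localCurvature (g.inChart P) (chartAt E P P) x y : E →ₗ[ℝ] E))
    (fun x x' y => by ext z; simp [localCurvature]; abel)
    (fun c x y => by ext z; simp [localCurvature, smul_sub, smul_add])
    (fun x y y' => by ext z; simp [localCurvature]; abel)
    (fun c x y => by ext z; simp [localCurvature, smul_sub, smul_add])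

lemma modelCurvature_apply (x y z : E) :
    g.modelCurvature P x y z = localCurvature (g.inChart P) (chartAt E P P) x y z := rfl

lemma curvature_eq :
    (g.curvature P : E → E → Module.End ℝ E) = fun x y => g.modelCurvature P x y := by
  have h : ∀ D : E →L[ℝ] E, D = ContinuousLinearMap.id ℝ E → ∀ x y,
      D.inverse.toLinearMap ∘ₗ
        (localCurvature (g.inChart P) (chartAt E P P) (D x) (D y)).toLinearMap ∘ₗ D.toLinearMap = g.modelCurvature P x y := by
    rintro _ rfl x y
    rw [ContinuousLinearMap.inverse_id]
    rfl
  funext x y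
  exact h _ (chartDeriv_eq_id P) x y

lemma isCurvatureTensor [FiniteDimensional ℝ E] :
    IsCurvatureTensor (curvatureForm (g.modelForm P) (g.modelCurvature P)) := by
  have h := g.isMetricNear_inChart P
  refine ⟨fun x y z w => ?_, fun x y z w => ?_, fun x y z w => ?_⟩
  · simp only [curvatureForm_apply, modelCurvature_apply,
      IsMetricNear.localCurvature_swap x y z, map_neg, LinearMap.neg_apply]
  · simp only [curvatureForm_apply, modelCurvature_apply, modelForm_apply]
    exact h.localCurvature_skew x y z w
  · simp only [curvatureForm_apply, modelCurvature_apply, ← LinearMap.add_apply, ← map_add,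
      h.localCurvature_bianchi, map_zero, LinearMap.zero_apply]

/-- The theorem at a single point. -/
theorem isJordanStanilov_at [FiniteDimensional ℝ E] (hpq : (p = 0 ∧ q = 4) ∨ 5 ≤ q)
    (hIP : StanilovIP.IsJordanIvanovPetrova (g.form P) (g.curvature P) .spacelike)
    (hrank : StanilovIP.HasConstantRank (g.form P) (g.curvature P) .spacelike 2)
    (ε : Causal) (k : ℕ) :
    StanilovIP.IsJordanStanilov (g.form P) (g.curvature P) ε k := by
  have hsig : HasSignature (g.modelForm P) p q := g.signature P
  have hsymm (x y : E) : g.modelForm P x y = g.modelForm P y x := g.symm P x y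
  have hIP' : StanilovIP.IsJordanIvanovPetrova (g.modelForm P)
      (fun x y => g.modelCurvature P x y) .spacelike := by
    rw [← curvature_eq]
    exact hIP
  have hrank' : StanilovIP.HasConstantRank (g.modelForm P)
      (fun x y => g.modelCurvature P x y) .spacelike 2 := by
    rw [← curvature_eq]
    exact hrank
  have hpos : 5 ≤ q ∨ 4 ≤ q ∧ ∀ v, v ≠ 0 → 0 < g.modelForm P v v := by
    obtain ⟨rfl, rfl⟩ | h := hpq
    · exact Or.inr ⟨le_rfl, hsig.posDef hsymm⟩
    · exact Or.inl h
  have := isJordanStanilov_of_isJordanIvanovPetrova hsig.1 hsymm hsig.hasPositiveIndex hpos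
    (g.isCurvatureTensor P) hrank' hIP' ε k
  rw [← curvature_eq] at this
  exact this

end PseudoRiemannianMetric
end Curvature

end StanilovIP

theorem theorem1p4 {E : Type*} [NormedAddCommGroup E] [NormedSpace ℝ E] [FiniteDimensional ℝ E]
    {M : Type*} [TopologicalSpace M] [ChartedSpace E M] [IsManifold 𝓘(ℝ, E) ∞ M]
    [T2Space M] [SecondCountableTopology M] [ConnectedSpace M]
    (p q : ℕ) (hpq : (p = 0 ∧ q = 4) ∨ 5 ≤ q)
    (g : StanilovIP.PseudoRiemannianMetric E M p q)
    (hIP : g.IsJordanIvanovPetrova .spacelike)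
    (hnil : g.HasNonNilpotentCurvature .spacelike)
    (hrank : g.HasConstantRank .spacelike 2) :
    (∀ k : ℕ, 2 ≤ k → k ≤ q → g.IsJordanStanilov .spacelike k) ∧
    (∀ k : ℕ, 2 ≤ k → k ≤ p → g.IsJordanStanilov .timelike k) :=
  ⟨fun k _ _ P => g.isJordanStanilov_at P hpq (hIP P) (hrank P) .spacelike k,
    fun k _ _ P => g.isJordanStanilov_at P hpq (hIP P) (hrank P) .timelike k⟩
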